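/- **Setting.** Let $\mathcal X$ and $\Omega$ be compact metric spaces (for instance $\mathcal X\subset\mathbb R$ compact), $\mathcal A$ and $\mathcal H$ finite sets, and $\mathcal Z_t=(\mathcal X\times\mathcal A)^{t-1}\times\mathcal X$ the space of trajectories $z=(x_1,a_1,\dots,a_{t-1},x_t)$, $t\ge 1$. A parameter $\omega\in\Omega$ is drawn from a Borel probability measure (the prior). Under $\omega$, the first observation has law $\rho_\omega$ and, after the trajectory $z\in\mathcal Z_t$ and the query $a\in\mathcal A$, the next observation has law $P^\omega_t(\cdot\mid z,a)$; the maps $\omega\mapsto\rho_\omega$ and $(\omega,z,a)\mapsto P^\omega_t(\cdot\mid z,a)$ are weakly continuous, and $\rho_\omega\ll\nu_0$, $P_t^\omega(\cdot\mid z,a)\ll\nu$ for two fixed probability measures $\nu_0,\nu$, with jointly measurable densities $p_0^\omega(x)$, $p_t^\omega(x\mid z,a)$. The true hypothesis $H^\star\in\mathcal H$ is a measurable function of $\omega$. A policy $\pi=(\pi_t)_{t\ge 1}$ is a sequence of measurable kernels from $\mathcal Z_t$ to $\mathcal A\cup\{a_{\rm stop}\}$, where choosing $a_{\rm stop}$ ends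 the interaction; $\mathcal D_t$ is the trajectory at time $t$ and $\tau=\inf\{t\ge 1:a_t=a_{\rm stop}\}\in\mathbb N\cup\{\infty\}$. An inference rule is a sequence $I=(I_t)_{t\ge 1}$ of measurable maps $\mathcal Z_t\to\mathcal H$. Probabilities $\mathbb P^\pi$ and expectations $\mathbb E^\pi$ include the draw of $\omega$, and events concerning $\mathcal D_\tau$ are understood on $\{\tau<\infty\}$. The posterior of $\omega$ given $\mathcal D_t=z$ is the normalized product of the prior and of the likelihood $p^\omega_0(x_1)\prod_{s<t}p^\omega_s(x_{s+1}\mid z_s,a_s)$ (and the prior where this cannot be normalized); it does not depend on the policy. Let $\mathbb P_t(H^\star=H\mid z)$ be the induced posterior of $H^\star$, $r_t(z)=\max_{H}\mathbb P_t(H^\star=H\mid z)$, and let $\bar P_t(\cdot\mid z,a)$ be the posterior mixture of the kernels $P_t^\omega(\cdot\mid z,a)$. For $\delta\in(0,1)$ and $\lambda\ge 0$ put $$V_\lambda(\pi,I)=-\mathbb E^\pi[\tau]+\lambda\big(\mathbb P^\pi(I_\tau(\mathcal D_\tau)=H^\star)-1+\delta\big)\in[-\infty,\infty).$$ Let $V_{t,\lambda}(z)=\sup_\pi\mathbb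 E^\pi[-(\tau-t)+\lambda r_\tau(\mathcal D_\tau)\mid \mathcal D_t=z,\ \tau\ge t]$ be the optimal value to go (where, given $\mathcal D_t=z$, later observations are drawn from the kernels $\bar P_s$), and $$Q_{t,\lambda}(z,a_{\rm stop})=\lambda r_t(z),\qquad Q_{t,\lambda}(z,a)=-1+\int V_{t+1,\lambda}(z,a,x)\,\bar P_t(dx\mid z,a)\quad(a\in\mathcal A).$$ **Theorem.** (1) For every $\lambda\ge 0$, the functions $Q_{t,\lambda}$ satisfy $$Q_{t,\lambda}(z,a)=-1+\int \max_{a'\in\mathcal A\cup\{a_{\rm stop}\}}Q_{t+1,\lambda}\big((z,a,x),a'\big)\,\bar P_t(dx\mid z,a),\qquad a\in\mathcal A,\ z\in\mathcal Z_t,\ t\ge 1,$$ where the integrand is integrable. There exist a deterministic greedy policy (one that only plays maximizers of $Q_{t,\lambda}(z,\cdot)$) and a maximum a posteriori inference rule ($I_t(z)\in\arg\max_H\mathbb P_t(H^\star=H\mid z)$). Every pair $(\pi^\star_\lambda,I^\star)$ of a policy that is greedy with respect to $Q_{t,\lambda}$ and a maximum a posteriori rule, with any tie-breaking, satisfies $V_\lambda(\pi^\star_\lambda,I^\star)=\sup_{\pi,I}V_\lambda(\pi,I)$.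 (2) Assume identifiability: for every $\varepsilon>0$ there is a policy $\pi$ with $\mathbb E^\pi[\tau]<\infty$ and $\mathbb E^\pi[r_\tau(\mathcal D_\tau)]\ge 1-\varepsilon$. Then the dual problem $\inf_{\lambda\ge 0}\sup_{\pi,I}V_\lambda(\pi,I)$ has an optimal $\lambda^\star\ge 0$. If $\lambda^\star$ is any optimal solution of it for which the maximizer $\pi$ of $-\mathbb E^\pi[\tau]+\lambda^\star(\mathbb E^\pi[r_\tau(\mathcal D_\tau)]-1+\delta)$ is unique, policies being identified when they induce the same joint law of $(\omega,\mathcal D_\tau)$ on $\{\tau<\infty\}$, then every greedy policy $\pi^\star_{\lambda^\star}$ with maximum a posteriori inference $I^\star$ is $\delta$-correct: $$\mathbb P^{\pi^\star_{\lambda^\star}}\big(I^\star_\tau(\mathcal D_\tau)=H^\star\big)\ge 1-\delta .$$ -/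

import Mathlib

open MeasureTheory ProbabilityTheory
open scoped ENNReal BoundedContinuousFunction

set_option linter.unusedSectionVars false

noncomputable section

namespace PureExploration

/-- Trajectories with `n` queries: the initial observation followed by `n` pairs
(query, observation). In one-based notation this is the space of `D_t`, with `t = n + 1`. -/
abbrev Hist (X A : Type*) (n : ℕ) : Type _ := X × (Fin n → A × X)

/-- The trajectory `(z, a, x)`. -/
def Hist.snoc {X A : Type*} {n : ℕ} (z : Hist X A n) (a : A) (x : X) : Hist X A (n + 1) :=
  (z.1, Fin.snoc (α := fun _ => A × X) z.2 (a, x))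

/-- The trajectory with the last query and the last observation removed. -/
def Hist.init {X A : Type*} {n : ℕ} (z : Hist X A (n + 1)) : Hist X A n :=
  (z.1, fun i => z.2 i.castSucc)

/-- Trajectories of arbitrary finite length; the values of `D_τ`. -/
abbrev Traj (X A : Type*) : Type _ := Σ n : ℕ, Hist X A n

section

variable {Ω X A 𝓗 : Type*} [MetricSpace Ω] [CompactSpace Ω] [MeasurableSpace Ω] [BorelSpace Ω]
  [MetricSpace X] [CompactSpace X] [MeasurableSpace X] [BorelSpace X]
  [Fintype A] [TopologicalSpace A] [DiscreteTopology A] [MeasurableSpace A]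
  [DiscreteMeasurableSpace A]
  [Fintype 𝓗] [MeasurableSpace 𝓗] [DiscreteMeasurableSpace 𝓗]

/-- A randomized policy on the action set `A ∪ {a_stop}`; the stop action is `none`. -/
structure Policy (X A : Type*) [MeasurableSpace X] [Fintype A] [MeasurableSpace A] where
  prob : (n : ℕ) → Hist X A n → Option A → ℝ≥0∞
  measurable_prob : ∀ n a, Measurable fun z => prob n z a
  sum_prob : ∀ n z, ∑ a, prob n z a = 1

/-- A sequence of inference rules. -/
structure InferenceRule (X A 𝓗 : Type*) [MeasurableSpace X] [MeasurableSpace A]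
    [MeasurableSpace 𝓗] where
  guess : (n : ℕ) → Hist X A n → 𝓗
  measurable_guess : ∀ n, Measurable (guess n)

/-- A Bayesian family of environments: a prior on a compact parameter space, initial laws and
history-dependent observation kernels, weakly continuous in all their arguments, and the
hypothesis which is true in the environment with parameter `ω`. -/
structure Model (Ω X A 𝓗 : Type*) [MetricSpace Ω] [MeasurableSpace Ω]
    [MetricSpace X] [MeasurableSpace X] [TopologicalSpace A] [MeasurableSpace A]
    [MeasurableSpace 𝓗] where
  prior : Measure Ω
  isProbabilityMeasure_prior : IsProbabilityMeasure prior
  init : Kernel Ω X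
  isMarkovKernel_init : IsMarkovKernel init
  trans : (n : ℕ) → Kernel (Ω × Hist X A n × A) X
  isMarkovKernel_trans : ∀ n, IsMarkovKernel (trans n)
  continuous_init : ∀ f : X →ᵇ ℝ, Continuous fun ω => ∫ x, f x ∂(init ω)
  continuous_trans : ∀ n, ∀ f : X →ᵇ ℝ, Continuous fun p => ∫ x, f x ∂(trans n p)
  truth : Ω → 𝓗
  measurable_truth : Measurable truth

/-- Domination of all initial laws by one probability measure and of all transition laws by
another one, with jointly measurable densities. -/
structure Model.Domination (M : Model Ω X A 𝓗) where
  base₀ : Measure X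
  isProbabilityMeasure_base₀ : IsProbabilityMeasure base₀
  base : Measure X
  isProbabilityMeasure_base : IsProbabilityMeasure base
  dens₀ : Ω → X → ℝ≥0∞
  measurable_dens₀ : Measurable fun p : Ω × X => dens₀ p.1 p.2
  init_eq : ∀ ω, M.init ω = base₀.withDensity (dens₀ ω)
  dens : (n : ℕ) → Ω × Hist X A n × A → X → ℝ≥0∞
  measurable_dens : ∀ n, Measurable fun p : (Ω × Hist X A n × A) × X => dens n p.1 p.2
  trans_eq : ∀ n p, M.trans n p = base.withDensity (dens n p)

/-! ### Laws of the interaction -/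

/-- Start at time `n` with a trajectory of law `μ`, then choose queries by `π` and draw
observations by `K`. This is the law of the trajectory `k` rounds later, restricted to the event
that the stop action was not chosen in these `k` rounds. -/
def runLaw (K : (n : ℕ) → Kernel (Hist X A n × A) X) (π : Policy X A) (n : ℕ)
    (μ : Measure (Hist X A n)) : (k : ℕ) → Measure (Hist X A (n + k))
  | 0 => μ
  | k + 1 => ∑ a : A,
      (((runLaw K π n μ k).withDensity fun z => π.prob (n + k) z (some a)) ⊗ₘ
        (K (n + k)).comap (fun z => (z, a)) (by fun_prop)).map
          fun p : Hist X A (n + k) × X => (p.1.snoc a p.2 : Hist X A (n + k + 1))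

/-- The law of the trajectory `D_τ` at the first time `τ` at which the stop action is chosen,
restricted to the event `τ < ∞`; the missing mass is the probability of `τ = ∞`. -/
def stoppedLaw (K : (n : ℕ) → Kernel (Hist X A n × A) X) (π : Policy X A) (n : ℕ)
    (μ : Measure (Hist X A n)) : Measure (Traj X A) :=
  Measure.sum fun k =>
    ((runLaw K π n μ k).withDensity fun z => π.prob (n + k) z none).map
      fun z => (⟨n + k, z⟩ : Traj X A)

/-- Joint law of the environment `ω ∼ prior` and of `D_τ`, restricted to `τ < ∞`. -/
def Model.pathLaw (M : Model Ω X A 𝓗) (π : Policy X A) : Measure (Ω × Traj X A) :=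
  M.prior.bind fun ω =>
    (Measure.dirac ω).prod (stoppedLaw (fun n => (M.trans n).sectR ω) π 0
      ((M.init ω).map fun x => ((x, Fin.elim0) : Hist X A 0)))

/-- `E[τ] = ∑ t * P(τ = t) + ∞ * P(τ = ∞)`; a stopped trajectory with `n` queries has
`τ = n + 1`. -/
def Model.expTau (M : Model Ω X A 𝓗) (π : Policy X A) : ℝ≥0∞ :=
  ∫⁻ p, ((p.2.1 + 1 : ℕ) : ℝ≥0∞) ∂(M.pathLaw π) + ⊤ * (1 - M.pathLaw π Set.univ)

/-- `P(I_τ(D_τ) = H⋆)`. -/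
def Model.correctness (M : Model Ω X A 𝓗) (π : Policy X A) (I : InferenceRule X A 𝓗) : ℝ :=
  (M.pathLaw π).real {p | I.guess p.2.1 p.2.2 = M.truth p.1}

/-- `V_λ(π, I) = -E[τ] + λ (P(I_τ(D_τ) = H⋆) - 1 + δ)`, equal to `-∞` if `E[τ] = ∞`. -/
def Model.lagrangian (M : Model Ω X A 𝓗) (δ lam : ℝ) (π : Policy X A)
    (I : InferenceRule X A 𝓗) : EReal :=
  -(M.expTau π : EReal) + ((lam * (M.correctness π I - 1 + δ) : ℝ) : EReal)

/-- The dual function `λ ↦ sup_{π, I} V_λ(π, I)`. -/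
def Model.dual (M : Model Ω X A 𝓗) (δ lam : ℝ) : EReal :=
  ⨆ π : Policy X A, ⨆ I : InferenceRule X A 𝓗, M.lagrangian δ lam π I

/-- `lam` attains the infimum in the dual problem `inf_{λ ≥ 0} sup_{π, I} V_λ(π, I)`. -/
def Model.IsDualOptimal (M : Model Ω X A 𝓗) (δ lam : ℝ) : Prop :=
  0 ≤ lam ∧ ∀ lam', 0 ≤ lam' → M.dual δ lam ≤ M.dual δ lam'

/-! ### Posterior -/

namespace Model.Domination

variable {M : Model Ω X A 𝓗} (D : M.Domination)

/-- The likelihood of a trajectory under the environment `ω`. -/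
def likelihood : (n : ℕ) → Ω → Hist X A n → ℝ≥0∞
  | 0, ω, z => D.dens₀ ω z.1
  | n + 1, ω, z => likelihood n ω z.init *
      D.dens n (ω, z.init, (z.2 (Fin.last n)).1) (z.2 (Fin.last n)).2

/-- The marginal likelihood of a trajectory. -/
def evidence (n : ℕ) (z : Hist X A n) : ℝ≥0∞ := ∫⁻ ω, D.likelihood n ω z ∂M.prior

theorem measurable_likelihood (n : ℕ) :
    Measurable fun p : Hist X A n × Ω => D.likelihood n p.2 p.1 := by
  induction n with
  | zero =>
    exact D.measurable_dens₀.comp (f := fun p : Hist X A 0 × Ω => (p.2, p.1.1)) (by fun_prop)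
  | succ n ih =>
    have h1 : Measurable fun p : Hist X A (n + 1) × Ω => ((p.1.init : Hist X A n), p.2) := by
      unfold Hist.init; fun_prop
    have h2 : Measurable fun p : Hist X A (n + 1) × Ω =>
        ((p.2, (p.1.init : Hist X A n), (p.1.2 (Fin.last n)).1), (p.1.2 (Fin.last n)).2) := by
      unfold Hist.init; fun_prop
    exact (ih.comp h1).mul ((D.measurable_dens n).comp h2)

open Classical in
/-- The posterior law of the environment given the trajectory: normalized likelihood times prior.
On the trajectories that cannot be normalized (a null set under every policy) it is the prior. -/
def posterior (n : ℕ) : Kernel (Hist X A n) Ω where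
  toFun z := if D.evidence n z = 0 ∨ D.evidence n z = ⊤ then M.prior
    else (D.evidence n z)⁻¹ • M.prior.withDensity fun ω => D.likelihood n ω z
  measurable' := by
    have := M.isProbabilityMeasure_prior
    have hev : Measurable (D.evidence n) := (D.measurable_likelihood n).lintegral_prod_right'
    refine Measurable.ite ?_ measurable_const ?_
    · exact (hev (measurableSet_singleton 0)).union (hev (measurableSet_singleton ⊤))
    · refine Measure.measurable_of_measurable_coe _ fun s hs => ?_
      simp only [Measure.smul_apply, smul_eq_mul, withDensity_apply _ hs]
      exact hev.inv.mul (D.measurable_likelihood n).lintegral_prod_right'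

/-- `P(H⋆ = H | D = z)`. -/
def hypPosterior (n : ℕ) (z : Hist X A n) (H : 𝓗) : ℝ :=
  (D.posterior n z).real (M.truth ⁻¹' {H})

/-- `r(z) = max_H P(H⋆ = H | D = z)`. -/
def maxPosterior (n : ℕ) (z : Hist X A n) : ℝ := ⨆ H : 𝓗, D.hypPosterior n z H

/-- The posterior mixture of the observation kernels: the law of the next observation given the
trajectory and the query. -/
def predictive (n : ℕ) : Kernel (Hist X A n × A) X :=
  M.trans n ∘ₖ ((D.posterior n).comap Prod.fst measurable_fst ×ₖ Kernel.id)

/-! ### Values -/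

/-- The conditional law of `D_τ`, restricted to `τ < ∞`, given `D_t = z` and `τ ≥ t`. -/
def condLaw (n : ℕ) (z : Hist X A n) (π : Policy X A) : Measure (Traj X A) :=
  stoppedLaw D.predictive π n (Measure.dirac z)

/-- `E^π[τ - t | D_t = z, τ ≥ t]`. -/
def expRemaining (n : ℕ) (z : Hist X A n) (π : Policy X A) : ℝ≥0∞ :=
  ∫⁻ o, ((o.1 - n : ℕ) : ℝ≥0∞) ∂(D.condLaw n z π) + ⊤ * (1 - D.condLaw n z π Set.univ)

/-- `E^π[-(τ - t) + λ r_τ(D_τ) | D_t = z, τ ≥ t]`, equal to `-∞` if the conditional expectation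
of `τ` is infinite. -/
def policyValue (lam : ℝ) (n : ℕ) (z : Hist X A n) (π : Policy X A) : EReal :=
  -(D.expRemaining n z π : EReal) +
    ((lam * ∫ o, D.maxPosterior o.1 o.2 ∂(D.condLaw n z π) : ℝ) : EReal)

/-- The optimal value to go. -/
def value (lam : ℝ) (n : ℕ) (z : Hist X A n) : ℝ :=
  (⨆ π : Policy X A, D.policyValue lam n z π).toReal

/-- The optimal action values `Q_{t,λ}`: a query costs `1` and is followed by optimal play, the
stop action earns `λ` times the maximal posterior probability. -/
def qValue (lam : ℝ) (n : ℕ) (z : Hist X A n) : Option A → ℝ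
  | none => lam * D.maxPosterior n z
  | some a => -1 + ∫ x, D.value lam (n + 1) (z.snoc a x) ∂(D.predictive n (z, a))

/-- The policy only plays actions that maximize `Q_{t,λ}` (arbitrary tie-breaking). -/
def IsGreedy (lam : ℝ) (π : Policy X A) : Prop :=
  ∀ n z a, π.prob n z a ≠ 0 → ∀ b, D.qValue lam n z b ≤ D.qValue lam n z a

/-- Maximum a posteriori inference (arbitrary tie-breaking). -/
def IsMAP (I : InferenceRule X A 𝓗) : Prop :=
  ∀ n z H, D.hypPosterior n z H ≤ D.hypPosterior n z (I.guess n z)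

/-- `E^π[r_τ(D_τ)]`. -/
def expMaxPosterior (π : Policy X A) : ℝ :=
  ∫ p, D.maxPosterior p.2.1 p.2.2 ∂(M.pathLaw π)

/-- Identifiability: every confidence level below one is reached in finite expected time. -/
def Identifiable : Prop :=
  ∀ ε : ℝ, 0 < ε → ∃ π : Policy X A, M.expTau π < ⊤ ∧ 1 - ε ≤ D.expMaxPosterior π

/-- `V_λ(π) = -E[τ] + λ (E[r_τ(D_τ)] - 1 + δ)`. -/
def policyLagrangian (δ lam : ℝ) (π : Policy X A) : EReal :=
  -(M.expTau π : EReal) + ((lam * (D.expMaxPosterior π - 1 + δ) : ℝ) : EReal)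

/-- `π` maximizes `V_λ`. -/
def IsOptimalPolicy (δ lam : ℝ) (π : Policy X A) : Prop :=
  ∀ π' : Policy X A, D.policyLagrangian δ lam π' ≤ D.policyLagrangian δ lam π

/-- The `λ`-optimal policy is unique, where two policies are identified if they generate the same
law of the environment and the stopped trajectory (they differ only where they are never
used). -/
def UniqueOptimalPolicy (δ lam : ℝ) : Prop :=
  ∀ π π' : Policy X A, D.IsOptimalPolicy δ lam π → D.IsOptimalPolicy δ lam π' →
    M.pathLaw π = M.pathLaw π'

end Model.Domination

end

end PureExploration

end

open PureExploration

/-! Averaging over the prior turns the problem into optimal stopping of a single observed process.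
By Bayes' rule and Tonelli, applied to densities with respect to a run whose observations come from
the dominating measures, `D_τ` has the law of a run with the predictive kernels, and the posterior
is the conditional law of `ω` given `D_τ` (`lintegral_pathLaw`). Hence `E[τ]`, the correctness and
`E[r_τ]` depend only on the predictive run, and a maximum a posteriori rule is the best inference
for every policy.

For the reward `l * r ≤ l` and unit cost per query, the optimal value `vOpt` is the increasing limit
of the finite-horizon values, and monotone convergence gives its Bellman equation (`vOpt_add_one`).
Along any policy `vOpt` is superharmonic up to the query cost, which bounds what the policy earns
(`reward_le_vOpt_add_expQueries`). Along a greedy policy equality holds at each step. Such a policy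
makes at most `l` queries on average, so the surviving mass vanishes and the telescoped identity
passes to the limit (`PlaysOptimal.reward_eq`). This is part (1).

For part (2), the dual function is the real function `optValue lam - 1 - lam * (1 - δ)`. It is
continuous, and identifiability makes it coercive on `[0, ∞)`, so a minimizer exists. At a minimizer
every right difference quotient of `optValue` is at least `1 - δ`. An envelope argument transfers
this slope to a policy: with finitely many actions, the maximizers for a slightly larger multiplier
are already maximizers, so some greedy action carries the upper right derivative forward
(`exists_vDer_le_qDer`). Along the greedy policy that selects such actions the derivative is a
bounded subharmonic potential that ends below `r_τ`, whence `E[r_τ] ≥ 1 - δ`. Uniqueness of the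
optimal policy extends the bound to every greedy policy. -/

open Filter

namespace PureExploration

section Control

variable {X A : Type*} [MeasurableSpace X] [Fintype A] [MeasurableSpace A]

/-! ### Trajectories -/

theorem Hist.init_snoc {n : ℕ} (z : Hist X A n) (a : A) (x : X) : (z.snoc a x).init = z := by
  ext i <;> simp [Hist.init, Hist.snoc]

theorem Hist.snoc_last {n : ℕ} (z : Hist X A n) (a : A) (x : X) :
    (z.snoc a x).2 (Fin.last n) = (a, x) := by
  simp [Hist.snoc]

theorem measurable_snoc {n : ℕ} (a : A) :
    Measurable fun p : Hist X A n × X => p.1.snoc a p.2 := by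
  unfold Hist.snoc
  refine Measurable.prodMk (by fun_prop) (measurable_pi_lambda _ fun i => ?_)
  refine Fin.lastCases ?_ (fun j => ?_) i
  · simpa using measurable_const.prodMk measurable_snd
  · simp only [Fin.snoc_castSucc]
    fun_prop

theorem measurable_trajMk (n : ℕ) : Measurable fun z : Hist X A n => (⟨n, z⟩ : Traj X A) :=
  Measurable.of_le_map (iInf_le _ n)

theorem measurable_traj {β : Type*} [MeasurableSpace β] {f : Traj X A → β}
    (h : ∀ n, Measurable fun z => f ⟨n, z⟩) : Measurable f := by
  intro s hs
  rw [MeasurableSpace.measurableSet_iInf]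
  exact fun n => h n hs

/-! ### Integrals along a run -/

section Run

variable (K : (n : ℕ) → Kernel (Hist X A n × A) X) [∀ n, IsMarkovKernel (K n)]
  (π : Policy X A) {n : ℕ} (μ : Measure (Hist X A n)) [IsFiniteMeasure μ]

theorem Policy.prob_none_add_sum (n : ℕ) (z : Hist X A n) :
    π.prob n z none + ∑ a, π.prob n z (some a) = 1 := by
  rw [← Fintype.sum_option, π.sum_prob]

theorem Policy.prob_le_one (n : ℕ) (z : Hist X A n) (b : Option A) : π.prob n z b ≤ 1 := by
  rw [← π.sum_prob n z]
  exact Finset.single_le_sum (f := fun b => π.prob n z b) (fun _ _ => zero_le) (Finset.mem_univ b)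

theorem isFiniteMeasure_withDensity_prob (μ : Measure (Hist X A n)) [IsFiniteMeasure μ]
    (b : Option A) : IsFiniteMeasure (μ.withDensity fun z => π.prob n z b) := by
  refine isFiniteMeasure_withDensity (ne_top_of_le_ne_top (measure_ne_top μ Set.univ) ?_)
  refine (lintegral_mono fun z => π.prob_le_one n z b).trans ?_
  simp

instance isFiniteMeasure_runLaw (k : ℕ) : IsFiniteMeasure (runLaw K π n μ k) := by
  induction k with
  | zero => exact ‹IsFiniteMeasure μ›
  | succ k ih =>
    have := fun b => isFiniteMeasure_withDensity_prob π (runLaw K π n μ k) b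
    unfold runLaw
    infer_instance

theorem measurable_lintegral_snoc {n : ℕ} {f : Hist X A (n + 1) → ℝ≥0∞} (hf : Measurable f)
    (a : A) : Measurable fun z : Hist X A n => ∫⁻ x, f (z.snoc a x) ∂K n (z, a) :=
  Measurable.lintegral_kernel_prod_right (κ := (K n).comap (fun z => (z, a)) (by fun_prop))
    (f := fun z x => f (z.snoc a x)) (hf.comp (measurable_snoc a))

/-- The one-step formula on which every induction along a run rests: run laws are only ever used
through integrals of nonnegative measurable functions. -/
theorem lintegral_runLaw_succ (k : ℕ) {f : Hist X A (n + k + 1) → ℝ≥0∞} (hf : Measurable f) :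
    ∫⁻ z, f z ∂runLaw K π n μ (k + 1) =
      ∫⁻ z, ∑ a, π.prob (n + k) z (some a) * ∫⁻ x, f (z.snoc a x) ∂K (n + k) (z, a)
        ∂runLaw K π n μ k := by
  have := fun b => isFiniteMeasure_withDensity_prob π (runLaw K π n μ k) b
  have hm : ∀ a, Measurable fun z => π.prob (n + k) z (some a) *
      ∫⁻ x, f (z.snoc a x) ∂K (n + k) (z, a) := fun a =>
    (π.measurable_prob _ _).mul (measurable_lintegral_snoc K hf a)
  rw [lintegral_finsetSum _ fun a _ => hm a]
  simp only [runLaw]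
  rw [lintegral_finsetSum_measure]
  refine Finset.sum_congr rfl fun a _ => ?_
  refine (lintegral_map hf (measurable_snoc a)).trans ?_
  refine (Measure.lintegral_compProd (hf.comp (measurable_snoc a))).trans ?_
  exact lintegral_withDensity_eq_lintegral_mul _ (π.measurable_prob _ _)
    (measurable_lintegral_snoc K hf a)

theorem runLaw_univ_succ (k : ℕ) :
    runLaw K π n μ (k + 1) Set.univ =
      ∫⁻ z, ∑ a, π.prob (n + k) z (some a) ∂runLaw K π n μ k := by
  rw [← lintegral_one, lintegral_runLaw_succ K π μ k (f := fun _ => 1) measurable_const]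
  simp

theorem runLaw_univ (k : ℕ) :
    runLaw K π n μ k Set.univ =
      ∫⁻ z, π.prob (n + k) z none ∂runLaw K π n μ k + runLaw K π n μ (k + 1) Set.univ := by
  rw [runLaw_univ_succ, ← lintegral_add_left (π.measurable_prob _ _)]
  simp [π.prob_none_add_sum]

theorem lintegral_stoppedLaw {f : Traj X A → ℝ≥0∞} (hf : Measurable f) :
    ∫⁻ o, f o ∂stoppedLaw K π n μ =
      ∑' k, ∫⁻ z, π.prob (n + k) z none * f ⟨n + k, z⟩ ∂runLaw K π n μ k := by
  rw [stoppedLaw, lintegral_sum_measure]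
  refine tsum_congr fun k => ?_
  rw [lintegral_map hf (measurable_trajMk _)]
  exact lintegral_withDensity_eq_lintegral_mul _ (π.measurable_prob _ _)
    (hf.comp (measurable_trajMk _))

theorem stoppedLaw_univ :
    stoppedLaw K π n μ Set.univ = ∑' k, ∫⁻ z, π.prob (n + k) z none ∂runLaw K π n μ k := by
  rw [← lintegral_one, lintegral_stoppedLaw K π μ (f := fun _ => 1) measurable_const]
  simp

instance sFinite_stoppedLaw : SFinite (stoppedLaw K π n μ) := by
  have := fun k => isFiniteMeasure_withDensity_prob π (runLaw K π n μ k) none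
  unfold stoppedLaw
  infer_instance

/-- A potential that decreases along the run, up to a cost `c` per query, dominates the expected
terminal reward. -/
theorem sum_lintegral_le_of_superharmonic {G f : (n : ℕ) → Hist X A n → ℝ≥0∞}
    (hG : ∀ n, Measurable (G n)) (hf : ∀ n, Measurable (f n)) (c : ℝ≥0∞)
    (h : ∀ n z, π.prob n z none * f n z +
      ∑ a, π.prob n z (some a) * ∫⁻ x, G (n + 1) (z.snoc a x) ∂K n (z, a) ≤
        G n z + c * ∑ a, π.prob n z (some a)) (k : ℕ) :
    ∑ j ∈ Finset.range k, ∫⁻ z, π.prob (n + j) z none * f (n + j) z ∂runLaw K π n μ j +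
        ∫⁻ z, G (n + k) z ∂runLaw K π n μ k ≤
      ∫⁻ z, G n z ∂μ + c * ∑ j ∈ Finset.range k, runLaw K π n μ (j + 1) Set.univ := by
  induction k with
  | zero => simp [runLaw]
  | succ k ih =>
    have hs : ∫⁻ z, π.prob (n + k) z none * f (n + k) z ∂runLaw K π n μ k +
        ∫⁻ z, G (n + k + 1) z ∂runLaw K π n μ (k + 1) ≤
        ∫⁻ z, G (n + k) z ∂runLaw K π n μ k + c * runLaw K π n μ (k + 1) Set.univ := by
      have hm : Measurable fun z => π.prob (n + k) z none * f (n + k) z :=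
        (π.measurable_prob _ _).mul (hf _)
      rw [lintegral_runLaw_succ K π μ k (hG _), runLaw_univ_succ, ← lintegral_add_left hm,
        ← lintegral_const_mul _ (Finset.measurable_sum _ fun a _ => π.measurable_prob _ _),
        ← lintegral_add_left (hG _)]
      exact lintegral_mono fun z => h _ z
    rw [Finset.sum_range_succ, Finset.sum_range_succ, add_assoc, mul_add,
      ← add_assoc (∫⁻ z, G n z ∂μ)]
    refine (add_le_add_right hs _).trans ?_
    rw [← add_assoc]
    exact add_le_add_left ih _

/-- A potential that increases along the run, up to a cost `c` per query, is dominated by the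
expected terminal reward. -/
theorem le_sum_lintegral_of_subharmonic {G f : (n : ℕ) → Hist X A n → ℝ≥0∞}
    (hG : ∀ n, Measurable (G n)) (hf : ∀ n, Measurable (f n)) (c : ℝ≥0∞)
    (h : ∀ n z, G n z + c * ∑ a, π.prob n z (some a) ≤ π.prob n z none * f n z +
      ∑ a, π.prob n z (some a) * ∫⁻ x, G (n + 1) (z.snoc a x) ∂K n (z, a)) (k : ℕ) :
    ∫⁻ z, G n z ∂μ + c * ∑ j ∈ Finset.range k, runLaw K π n μ (j + 1) Set.univ ≤
      ∑ j ∈ Finset.range k, ∫⁻ z, π.prob (n + j) z none * f (n + j) z ∂runLaw K π n μ j +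
        ∫⁻ z, G (n + k) z ∂runLaw K π n μ k := by
  induction k with
  | zero => simp [runLaw]
  | succ k ih =>
    have hs : ∫⁻ z, G (n + k) z ∂runLaw K π n μ k + c * runLaw K π n μ (k + 1) Set.univ ≤
        ∫⁻ z, π.prob (n + k) z none * f (n + k) z ∂runLaw K π n μ k +
        ∫⁻ z, G (n + k + 1) z ∂runLaw K π n μ (k + 1) := by
      have hm : Measurable fun z => π.prob (n + k) z none * f (n + k) z :=
        (π.measurable_prob _ _).mul (hf _)
      rw [lintegral_runLaw_succ K π μ k (hG _), runLaw_univ_succ, ← lintegral_add_left hm,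
        ← lintegral_const_mul _ (Finset.measurable_sum _ fun a _ => π.measurable_prob _ _),
        ← lintegral_add_left (hG _)]
      exact lintegral_mono fun z => h _ z
    rw [Finset.sum_range_succ, Finset.sum_range_succ, add_assoc, mul_add, ← add_assoc]
    refine (add_le_add_left ih _).trans ?_
    rw [add_assoc]
    exact add_le_add_right hs _

end Run

/-! ### Expected stopping times -/

/-- Exchange the two sums: `s i` occurs in the tail after `k` exactly for the `i` indices `k < i`.
-/
theorem tsum_tail_eq_tsum_mul (s : ℕ → ℝ≥0∞) :
    ∑' k, ∑' j, s (k + 1 + j) = ∑' j : ℕ, (j : ℝ≥0∞) * s j := by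
  have h1 : ∀ k, ∑' j, s (k + 1 + j) = ∑' i, if k < i then s i else 0 := by
    intro k
    have h := Summable.sum_add_tsum_nat_add' (f := fun i => if k < i then s i else 0) (k := k + 1)
      ENNReal.summable
    rw [← h, Finset.sum_eq_zero, zero_add]
    · refine tsum_congr fun j => ?_
      rw [if_pos (by omega), add_comm]
    · intro i hi
      rw [if_neg]
      simpa [Nat.lt_succ_iff] using hi
  simp_rw [h1]
  rw [ENNReal.tsum_comm]
  refine tsum_congr fun i => ?_
  rw [tsum_eq_sum (s := Finset.range i)]
  · rw [Finset.sum_congr rfl (g := fun _ => s i)]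
    · simp
    · intro k hk
      simp [Finset.mem_range.1 hk]
  · intro k hk
    simpa using fun h => absurd h (by simpa using hk)

/-- Tail sum formula for a defective law: `m k` is the mass that survives `k` rounds and `s k`
the mass that stops in the next one. -/
theorem tsum_survival {m s : ℕ → ℝ≥0∞} (hms : ∀ k, m k = s k + m (k + 1)) (h0 : m 0 = 1) :
    ∑' k : ℕ, (k : ℝ≥0∞) * s k + ⊤ * (1 - ∑' k, s k) = ∑' k, m (k + 1) := by
  have hanti : Antitone m := antitone_nat_of_succ_le fun k => by
    rw [hms k]; exact le_add_self
  have hpart : ∀ k N, m k = ∑ j ∈ Finset.range N, s (k + j) + m (k + N) := by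
    intro k N
    induction N with
    | zero => simp
    | succ N ih => rw [Finset.sum_range_succ, add_assoc, ← add_assoc k N 1, ← hms, ← ih]
  have hlim : Tendsto m atTop (nhds (⨅ k, m k)) := tendsto_atTop_iInf hanti
  have htail : ∀ k, m k = ∑' j, s (k + j) + ⨅ k, m k := by
    intro k
    have h1 : Tendsto (fun N => ∑ j ∈ Finset.range N, s (k + j) + m (k + N)) atTop
        (nhds (∑' j, s (k + j) + ⨅ k, m k)) := by
      refine (ENNReal.tendsto_nat_tsum _).add ?_
      simp_rw [add_comm k]
      exact (tendsto_add_atTop_iff_nat k).2 hlim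
    refine tendsto_nhds_unique ?_ h1
    simp_rw [← hpart k]
    exact tendsto_const_nhds
  -- The defect of the stopping law is the limit of the survival masses, the probability of never
  -- stopping.
  have hL : 1 - ∑' k, s k = ⨅ k, m k := by
    have := htail 0
    rw [h0] at this
    simp only [zero_add] at this
    rw [this]
    refine ENNReal.add_sub_cancel_left (ne_top_of_le_ne_top ENNReal.one_ne_top ?_)
    rw [this]; exact le_self_add
  -- Every survival mass contains the mass that never stops. Summed over all `k` it becomes `⊤`
  -- times that mass, which is `0` when the mass is `0`.
  rw [hL, tsum_congr fun k => htail (k + 1), ENNReal.tsum_add, tsum_tail_eq_tsum_mul,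
    ENNReal.tsum_const]
  simp

section Time

variable (K : (n : ℕ) → Kernel (Hist X A n × A) X) [∀ n, IsMarkovKernel (K n)]
  (π : Policy X A) {n : ℕ} (μ : Measure (Hist X A n)) [IsProbabilityMeasure μ]

/-- The expected number of further queries, as a sum of survival probabilities. -/
noncomputable def expQueries (K : (n : ℕ) → Kernel (Hist X A n × A) X) (π : Policy X A) (n : ℕ)
    (μ : Measure (Hist X A n)) : ℝ≥0∞ :=
  ∑' k, runLaw K π n μ (k + 1) Set.univ

theorem lintegral_length_stoppedLaw :
    ∫⁻ o, ((o.1 - n : ℕ) : ℝ≥0∞) ∂stoppedLaw K π n μ + ⊤ * (1 - stoppedLaw K π n μ Set.univ) =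
      expQueries K π n μ := by
  rw [lintegral_stoppedLaw K π μ (f := fun o => ((o.1 - n : ℕ) : ℝ≥0∞))
    (measurable_traj fun m => measurable_const (a := ((m - n : ℕ) : ℝ≥0∞))), stoppedLaw_univ,
    expQueries,
    ← tsum_survival (fun k => runLaw_univ K π μ k) (by simp [runLaw])]
  congr 1
  refine tsum_congr fun k => ?_
  simp only [Nat.add_sub_cancel_left]
  rw [lintegral_mul_const _ (π.measurable_prob _ _), mul_comm]

theorem one_sub_stoppedLaw_univ_eq_zero (h : expQueries K π n μ ≠ ⊤) :
    1 - stoppedLaw K π n μ Set.univ = 0 := by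
  rw [← lintegral_length_stoppedLaw K π μ] at h
  by_contra h'
  exact h (by rw [ENNReal.top_mul h', add_top])

theorem stoppedLaw_univ_le : stoppedLaw K π n μ Set.univ ≤ 1 := by
  rw [stoppedLaw_univ]
  refine ENNReal.tsum_le_of_sum_range_le fun k => ?_
  -- The constant `1`, as potential and as terminal reward with no cost, expresses conservation of
  -- mass: stopped mass plus surviving mass.
  have := sum_lintegral_le_of_superharmonic K π μ (G := fun _ _ => 1) (f := fun _ _ => 1)
    (fun _ => measurable_const) (fun _ => measurable_const) 0 (by simp [π.prob_none_add_sum]) k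
  simpa using le_self_add.trans this

theorem runLaw_univ_le (k : ℕ) : runLaw K π n μ k Set.univ ≤ 1 := by
  have := sum_lintegral_le_of_superharmonic K π μ (G := fun _ _ => 1) (f := fun _ _ => 1)
    (fun _ => measurable_const) (fun _ => measurable_const) 0 (by simp [π.prob_none_add_sum]) k
  simpa using le_add_self.trans this

/-- A bounded potential that increases along the run, up to a cost `c` per query, is dominated by
the expected reward at the stopping time if that time is integrable. -/
theorem lintegral_add_le_of_subharmonic {G f : (n : ℕ) → Hist X A n → ℝ≥0∞}
    (hG : ∀ n, Measurable (G n)) (hf : ∀ n, Measurable (f n)) {c C : ℝ≥0∞} (hc : c ≠ ⊤)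
    (hC : C ≠ ⊤) (hGC : ∀ n z, G n z ≤ C) (hq : expQueries K π n μ ≠ ⊤)
    (h : ∀ n z, G n z + c * ∑ a, π.prob n z (some a) ≤ π.prob n z none * f n z +
      ∑ a, π.prob n z (some a) * ∫⁻ x, G (n + 1) (z.snoc a x) ∂K n (z, a)) :
    ∫⁻ z, G n z ∂μ + c * expQueries K π n μ ≤ ∫⁻ o, f o.1 o.2 ∂stoppedLaw K π n μ := by
  have hk : ∀ k, ∫⁻ z, G n z ∂μ +
      c * ∑ j ∈ Finset.range (k + 1), runLaw K π n μ (j + 1) Set.univ ≤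
      ∫⁻ o, f o.1 o.2 ∂stoppedLaw K π n μ + C * runLaw K π n μ (k + 1) Set.univ := by
    intro k
    refine (le_sum_lintegral_of_subharmonic K π μ hG hf c h (k + 1)).trans (add_le_add ?_ ?_)
    · rw [lintegral_stoppedLaw K π μ (f := fun o => f o.1 o.2) (measurable_traj hf)]
      exact ENNReal.sum_le_tsum _
    · refine (lintegral_mono fun z => hGC _ z).trans ?_
      rw [lintegral_const]
  have h1 : Tendsto (fun k => ∑ j ∈ Finset.range (k + 1), runLaw K π n μ (j + 1) Set.univ) atTop
      (nhds (expQueries K π n μ)) :=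
    (tendsto_add_atTop_iff_nat 1).2 (ENNReal.tendsto_nat_tsum _)
  -- The survival masses are the terms of a convergent series, so the potential left on the running
  -- trajectories, at most `C` times these masses, disappears in the limit.
  have h2 : Tendsto (fun k => runLaw K π n μ (k + 1) Set.univ) atTop (nhds 0) :=
    ENNReal.tendsto_atTop_zero_of_tsum_ne_top hq
  have h3 := (tendsto_const_nhds (x := ∫⁻ o, f o.1 o.2 ∂stoppedLaw K π n μ)).add
    (ENNReal.Tendsto.const_mul h2 (Or.inr hC))
  rw [mul_zero, add_zero] at h3
  exact le_of_tendsto_of_tendsto' (tendsto_const_nhds.add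
    (ENNReal.Tendsto.const_mul h1 (Or.inr hc))) h3 hk

end Time

end Control

/-! ### Measurable selection of maximizers -/

section Selection

/-- Finitely many measurable functions have a measurable selection of a maximizing index. -/
theorem exists_measurable_argmax {β ι : Type*} [MeasurableSpace β] [Fintype ι] [Nonempty ι]
    (q : ι → β → ℝ≥0∞) (hq : ∀ i, Measurable (q i)) :
    ∃ f : β → ι, (∀ i, MeasurableSet {z | f z = i}) ∧ ∀ z i, q i z ≤ q (f z) z := by
  classical
  let _ : MeasurableSpace ι := ⊤
  -- Induction on the set of candidates: the current winner is replaced on the measurable set where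
  -- the new candidate is at least as good.
  have key : ∀ s : Finset ι, ∃ f : β → ι, Measurable f ∧ ∀ z, ∀ i ∈ s, q i z ≤ q (f z) z := by
    intro s
    induction s using Finset.induction_on with
    | empty => exact ⟨fun _ => Classical.arbitrary ι, measurable_const, by simp⟩
    | insert i s _ ih =>
      obtain ⟨f, hf, hmax⟩ := ih
      have hqf : Measurable fun z => q (f z) z :=
        (measurable_from_prod_countable_right (f := fun p : ι × β => q p.1 p.2) hq).comp
          (hf.prodMk measurable_id)
      refine ⟨fun z => if q (f z) z ≤ q i z then i else f z,
        Measurable.ite (measurableSet_le hqf (hq i)) measurable_const hf, fun z j hj => ?_⟩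
      rw [Finset.mem_insert] at hj
      dsimp only
      split_ifs with hle
      · rcases hj with rfl | hj
        · exact le_rfl
        · exact (hmax z j hj).trans hle
      · rcases hj with rfl | hj
        · exact (not_le.1 hle).le
        · exact hmax z j hj
  obtain ⟨f, hf, hmax⟩ := key Finset.univ
  exact ⟨f, fun i => hf (MeasurableSpace.measurableSet_top (s := {i})),
    fun z i => hmax z i (Finset.mem_univ i)⟩

end Selection

section Control

variable {X A : Type*} [MeasurableSpace X] [Fintype A] [MeasurableSpace A]

open Classical in
/-- The deterministic policy that plays a measurable selection of actions. -/
noncomputable def Policy.ofSelection (f : (n : ℕ) → Hist X A n → Option A)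
    (hf : ∀ n b, MeasurableSet {z | f n z = b}) : Policy X A where
  prob n z b := if f n z = b then 1 else 0
  measurable_prob n b := Measurable.ite (hf n b) measurable_const measurable_const
  sum_prob n z := by simp

/-! ### Value iteration

A run earns the reward `l * r` when it is stopped and pays `1` for every query. -/

variable (K : (n : ℕ) → Kernel (Hist X A n × A) X) [∀ n, IsMarkovKernel (K n)]
  (r : (n : ℕ) → Hist X A n → ℝ≥0∞)

/-- The optimal value with at most `k` queries. -/
noncomputable def vIter (K : (n : ℕ) → Kernel (Hist X A n × A) X)
    (r : (n : ℕ) → Hist X A n → ℝ≥0∞) (l : ℝ≥0∞) : ℕ → (n : ℕ) → Hist X A n → ℝ≥0∞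
  | 0, n, z => l * r n z
  | k + 1, n, z => max (l * r n z)
      (⨆ a : A, ∫⁻ x, vIter K r l k (n + 1) (z.snoc a x) ∂K n (z, a) - 1)

/-- The optimal value. -/
noncomputable def vOpt (K : (n : ℕ) → Kernel (Hist X A n × A) X)
    (r : (n : ℕ) → Hist X A n → ℝ≥0∞) (l : ℝ≥0∞) (n : ℕ) (z : Hist X A n) : ℝ≥0∞ :=
  ⨆ k, vIter K r l k n z

/-- The optimal action values, increased by `1` so that they are nonnegative. -/
noncomputable def qOpt (K : (n : ℕ) → Kernel (Hist X A n × A) X)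
    (r : (n : ℕ) → Hist X A n → ℝ≥0∞) (l : ℝ≥0∞) (n : ℕ) (z : Hist X A n) : Option A → ℝ≥0∞
  | none => l * r n z + 1
  | some a => ∫⁻ x, vOpt K r l (n + 1) (z.snoc a x) ∂K n (z, a)

variable {r} {l : ℝ≥0∞}

theorem measurable_vIter (hr : ∀ n, Measurable (r n)) (l : ℝ≥0∞) (k n : ℕ) :
    Measurable (vIter K r l k n) := by
  induction k generalizing n with
  | zero => exact (hr n).const_mul l
  | succ k ih =>
    exact ((hr n).const_mul l).max
      (Measurable.iSup fun a => (measurable_lintegral_snoc K (ih (n + 1)) a).sub_const 1)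

theorem measurable_vOpt (hr : ∀ n, Measurable (r n)) (l : ℝ≥0∞) (n : ℕ) :
    Measurable (vOpt K r l n) :=
  Measurable.iSup fun k => measurable_vIter K hr l k n

theorem measurable_qOpt (hr : ∀ n, Measurable (r n)) (l : ℝ≥0∞) (n : ℕ) (b : Option A) :
    Measurable fun z => qOpt K r l n z b := by
  cases b with
  | none => exact ((hr n).const_mul l).add_const 1
  | some a => exact measurable_lintegral_snoc K (measurable_vOpt K hr l (n + 1)) a

theorem vIter_le_succ (k n : ℕ) (z : Hist X A n) :
    vIter K r l k n z ≤ vIter K r l (k + 1) n z := by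
  induction k generalizing n with
  | zero => exact le_max_left _ _
  | succ k ih =>
    exact max_le_max le_rfl
      (iSup_mono fun a => tsub_le_tsub_right (lintegral_mono fun x => ih _ _) 1)

theorem vIter_le (hr1 : ∀ n z, r n z ≤ 1) (k n : ℕ) (z : Hist X A n) :
    vIter K r l k n z ≤ l := by
  have h0 : ∀ n (z : Hist X A n), l * r n z ≤ l := fun n z => mul_le_of_le_one_right' (hr1 n z)
  induction k generalizing n with
  | zero => exact h0 n z
  | succ k ih =>
    refine max_le (h0 n z) (iSup_le fun a => tsub_le_self.trans ?_)
    refine (lintegral_mono fun x => ih _ _).trans ?_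
    simp

theorem vOpt_le (hr1 : ∀ n z, r n z ≤ 1) (n : ℕ) (z : Hist X A n) : vOpt K r l n z ≤ l :=
  iSup_le fun k => vIter_le K hr1 k n z

theorem lintegral_vOpt_snoc (hr : ∀ n, Measurable (r n)) (n : ℕ) (z : Hist X A n) (a : A) :
    ∫⁻ x, vOpt K r l (n + 1) (z.snoc a x) ∂K n (z, a) =
      ⨆ k, ∫⁻ x, vIter K r l k (n + 1) (z.snoc a x) ∂K n (z, a) := by
  refine lintegral_iSup (fun k => ?_) (monotone_nat_of_le_succ fun k x => vIter_le_succ K k _ _)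
  exact (measurable_vIter K hr l k (n + 1)).comp
    ((measurable_snoc a).comp (measurable_const.prodMk measurable_id))

/-- The Bellman equation, with `1` added so that truncated subtraction does no harm: stopping alone
makes the right side at least `1`. One inequality is checked horizon by horizon; the other is
monotone convergence, since a longer horizon never lowers the value. -/
theorem vOpt_add_one (hr : ∀ n, Measurable (r n)) (n : ℕ) (z : Hist X A n) :
    vOpt K r l n z + 1 = ⨆ b, qOpt K r l n z b := by
  apply le_antisymm
  · have h1 : l * r n z + 1 ≤ ⨆ b, qOpt K r l n z b := le_iSup (qOpt K r l n z) none
    have h2 : vOpt K r l n z ≤ (⨆ b, qOpt K r l n z b) - 1 := by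
      have h3 : l * r n z ≤ (⨆ b, qOpt K r l n z b) - 1 :=
        ENNReal.le_sub_of_add_le_right ENNReal.one_ne_top h1
      refine iSup_le fun k => ?_
      cases k with
      | zero => exact h3
      | succ k =>
        refine max_le h3 (iSup_le fun a => tsub_le_tsub_right ?_ 1)
        refine le_trans (lintegral_mono fun x => ?_) (le_iSup (qOpt K r l n z) (some a))
        exact le_iSup (fun k => vIter K r l k (n + 1) (z.snoc a x)) k
    calc vOpt K r l n z + 1 ≤ ((⨆ b, qOpt K r l n z b) - 1) + 1 := by gcongr
      _ = _ := tsub_add_cancel_of_le (le_add_self.trans h1)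
  · refine iSup_le fun b => ?_
    cases b with
    | none =>
      exact add_le_add_left (le_iSup (fun k => vIter K r l k n z) 0) 1
    | some a =>
      simp only [qOpt]
      rw [lintegral_vOpt_snoc K hr]
      refine iSup_le fun k => ?_
      refine le_tsub_add.trans (add_le_add_left (le_trans ?_
        (le_iSup (fun k => vIter K r l k n z) (k + 1))) 1)
      exact le_max_of_le_right (le_iSup
        (fun a => ∫⁻ x, vIter K r l k (n + 1) (z.snoc a x) ∂K n (z, a) - 1) a)

theorem qOpt_le (hr : ∀ n, Measurable (r n)) (n : ℕ) (z : Hist X A n) (b : Option A) :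
    qOpt K r l n z b ≤ vOpt K r l n z + 1 := by
  rw [vOpt_add_one K hr]
  exact le_iSup (qOpt K r l n z) b

theorem exists_qOpt_eq (hr : ∀ n, Measurable (r n)) (n : ℕ) (z : Hist X A n) :
    ∃ b, qOpt K r l n z b = vOpt K r l n z + 1 := by
  rw [vOpt_add_one K hr]
  exact exists_eq_ciSup_of_finite

/-- The policy only plays actions of maximal value. -/
def PlaysOptimal (K : (n : ℕ) → Kernel (Hist X A n × A) X)
    (r : (n : ℕ) → Hist X A n → ℝ≥0∞) (l : ℝ≥0∞) (π : Policy X A) : Prop :=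
  ∀ n z b, π.prob n z b ≠ 0 → qOpt K r l n z b = vOpt K r l n z + 1

/-- Splits a value and the query cost over the actions, so that drift conditions can be checked
action by action: stopping against `v`, each query against `v + 1`, the form in which `qOpt` is
normalized. -/
theorem Policy.sum_mul_add (π : Policy X A) (n : ℕ) (z : Hist X A n) (v : ℝ≥0∞) :
    v + 1 * ∑ a, π.prob n z (some a) =
      π.prob n z none * v + ∑ a, π.prob n z (some a) * (v + 1) := by
  have h := congrArg (fun t => t * v) (π.prob_none_add_sum n z)
  simp only [add_mul, one_mul, Finset.sum_mul] at h
  simp only [mul_add, mul_one, one_mul, Finset.sum_add_distrib]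
  rw [← add_assoc, h]

/-! ### Verification: bounds for all policies, equality for greedy ones -/

section Optimality

variable (π : Policy X A) {n : ℕ} (μ : Measure (Hist X A n)) [IsProbabilityMeasure μ]

theorem mul_lintegral_stoppedLaw (hr : ∀ n, Measurable (r n)) :
    l * ∫⁻ o, r o.1 o.2 ∂stoppedLaw K π n μ = ∫⁻ o, l * r o.1 o.2 ∂stoppedLaw K π n μ :=
  (lintegral_const_mul l (measurable_traj (f := fun o => r o.1 o.2) hr)).symm

/-- By the Bellman inequality `vOpt` is superharmonic up to the unit cost. With the cost on the
right no integrability is needed: a policy with infinite expected number of queries satisfies the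
bound trivially. -/
theorem reward_le_vOpt_add_expQueries (hr : ∀ n, Measurable (r n)) :
    l * ∫⁻ o, r o.1 o.2 ∂stoppedLaw K π n μ ≤
      ∫⁻ z, vOpt K r l n z ∂μ + expQueries K π n μ := by
  have hm : ∀ n, Measurable fun z => l * r n z := fun n => (hr n).const_mul l
  rw [mul_lintegral_stoppedLaw K π μ hr,
    lintegral_stoppedLaw K π μ (f := fun o => l * r o.1 o.2) (measurable_traj hm)]
  refine ENNReal.tsum_le_of_sum_range_le fun k => ?_
  have h := sum_lintegral_le_of_superharmonic K π μ (G := vOpt K r l)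
    (f := fun n z => l * r n z) (measurable_vOpt K hr l) hm 1 (fun n z => ?_) k
  · refine (le_self_add.trans h).trans ?_
    rw [one_mul]
    exact add_le_add_right (ENNReal.sum_le_tsum _) _
  · rw [π.sum_mul_add]
    refine add_le_add ?_ (Finset.sum_le_sum fun a _ => ?_)
    · gcongr
      exact le_iSup (fun k => vIter K r l k n z) 0
    · gcongr
      exact qOpt_le K hr n z (some a)

variable {π}

theorem PlaysOptimal.subharmonic (hπ : PlaysOptimal K r l π) (n : ℕ) (z : Hist X A n) :
    vOpt K r l n z + 1 * ∑ a, π.prob n z (some a) ≤ π.prob n z none * (l * r n z) +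
      ∑ a, π.prob n z (some a) * ∫⁻ x, vOpt K r l (n + 1) (z.snoc a x) ∂K n (z, a) := by
  rw [π.sum_mul_add]
  refine add_le_add ?_ (Finset.sum_le_sum fun a _ => ?_)
  · by_cases h : π.prob n z none = 0
    · simp [h]
    · have := hπ n z none h
      simp only [qOpt] at this
      rw [(ENNReal.add_left_inj ENNReal.one_ne_top).1 this]
  · by_cases h : π.prob n z (some a) = 0
    · simp [h]
    · rw [← hπ n z (some a) h]
      rfl

/-- The queries of the first `k` rounds are paid for by the reward of the stopped runs and the value
left on the surviving ones. Both are at most `l` per unit of mass, and the total mass is at most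
`1`. -/
theorem PlaysOptimal.expQueries_le (hr : ∀ n, Measurable (r n)) (hr1 : ∀ n z, r n z ≤ 1)
    (hπ : PlaysOptimal K r l π) : expQueries K π n μ ≤ l := by
  have hm : ∀ n, Measurable fun z => l * r n z := fun n => (hr n).const_mul l
  refine ENNReal.tsum_le_of_sum_range_le fun k => ?_
  have h1 := le_sum_lintegral_of_subharmonic K π μ (G := vOpt K r l)
    (f := fun n z => l * r n z) (measurable_vOpt K hr l) hm 1 (hπ.subharmonic K) k
  have h2 := sum_lintegral_le_of_superharmonic K π μ (G := fun _ _ => l) (f := fun _ _ => l)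
    (fun _ => measurable_const) (fun _ => measurable_const) 0
    (fun n z => by simp [← Finset.sum_mul, ← add_mul, π.prob_none_add_sum]) k
  rw [one_mul] at h1
  refine (le_add_self.trans h1).trans (le_trans ?_ (h2.trans (by simp)))
  refine add_le_add (Finset.sum_le_sum fun j _ => lintegral_mono fun z => ?_)
    (lintegral_mono fun z => vOpt_le K hr1 _ z)
  exact mul_le_mul_right (mul_le_of_le_one_right' (hr1 _ z)) _

/-- The reverse inequality follows by telescoping the greedy equality; the bound on the expected
number of queries justifies the passage to the limit. -/
theorem PlaysOptimal.reward_eq (hr : ∀ n, Measurable (r n)) (hr1 : ∀ n z, r n z ≤ 1)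
    (hl : l ≠ ⊤) (hπ : PlaysOptimal K r l π) :
    l * ∫⁻ o, r o.1 o.2 ∂stoppedLaw K π n μ =
      ∫⁻ z, vOpt K r l n z ∂μ + expQueries K π n μ := by
  refine le_antisymm (reward_le_vOpt_add_expQueries K π μ hr) ?_
  have h := lintegral_add_le_of_subharmonic K π μ (G := vOpt K r l) (f := fun n z => l * r n z)
    (measurable_vOpt K hr l) (fun n => (hr n).const_mul l) ENNReal.one_ne_top hl (vOpt_le K hr1)
    (ne_top_of_le_ne_top hl (hπ.expQueries_le K μ hr hr1)) (hπ.subharmonic K)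
  rwa [one_mul, ← mul_lintegral_stoppedLaw K π μ hr] at h

end Optimality

end Control

section Derivative

variable {X A : Type*} [MeasurableSpace X] [Fintype A] [MeasurableSpace A]
  (K : (n : ℕ) → Kernel (Hist X A n × A) X) [∀ n, IsMarkovKernel (K n)]
  {r : (n : ℕ) → Hist X A n → ℝ≥0∞} {l l' : ℝ≥0∞}

/-! ### Dependence of the optimal value on the multiplier -/

theorem vIter_mono (h : l ≤ l') (k n : ℕ) (z : Hist X A n) :
    vIter K r l k n z ≤ vIter K r l' k n z := by
  induction k generalizing n with
  | zero => exact mul_le_mul_left h _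
  | succ k ih =>
    exact max_le_max (mul_le_mul_left h _)
      (iSup_mono fun a => tsub_le_tsub_right (lintegral_mono fun x => ih _ _) 1)

/-- Since `r ≤ 1`, raising the multiplier by `h` raises the terminal reward by at most `h`; maxima,
averages over probability kernels and subtraction of `1` do not amplify the difference. -/
theorem vIter_add_le (hr1 : ∀ n z, r n z ≤ 1) (h : ℝ≥0∞) (k n : ℕ) (z : Hist X A n) :
    vIter K r (l + h) k n z ≤ vIter K r l k n z + h := by
  have h0 : ∀ n (z : Hist X A n), (l + h) * r n z ≤ l * r n z + h := fun n z => by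
    rw [add_mul]
    exact add_le_add_right (mul_le_of_le_one_right' (hr1 n z)) _
  induction k generalizing n with
  | zero => exact h0 n z
  | succ k ih =>
    refine max_le ((h0 n z).trans (add_le_add_left (le_max_left _ _) h)) (iSup_le fun a => ?_)
    have h1 : ∫⁻ x, vIter K r (l + h) k (n + 1) (z.snoc a x) ∂K n (z, a) ≤
        ∫⁻ x, vIter K r l k (n + 1) (z.snoc a x) ∂K n (z, a) + h := by
      refine (lintegral_mono fun x => ih _ _).trans ?_
      rw [lintegral_add_right _ measurable_const]
      simp
    refine (tsub_le_tsub_right h1 1).trans (add_tsub_le_tsub_add.trans (add_le_add_left ?_ h))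
    exact le_max_of_le_right (le_iSup
        (fun a => ∫⁻ x, vIter K r l k (n + 1) (z.snoc a x) ∂K n (z, a) - 1) a)

theorem vOpt_mono (h : l ≤ l') (n : ℕ) (z : Hist X A n) :
    vOpt K r l n z ≤ vOpt K r l' n z :=
  iSup_mono fun k => vIter_mono K h k n z

theorem vOpt_add_le (hr1 : ∀ n z, r n z ≤ 1) (h : ℝ≥0∞) (n : ℕ) (z : Hist X A n) :
    vOpt K r (l + h) n z ≤ vOpt K r l n z + h :=
  iSup_le fun k => (vIter_add_le K hr1 h k n z).trans
    (add_le_add_left (le_iSup (fun k => vIter K r l k n z) k) h)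

theorem qOpt_add_le (hr1 : ∀ n z, r n z ≤ 1) (h : ℝ≥0∞) (n : ℕ) (z : Hist X A n)
    (b : Option A) : qOpt K r (l + h) n z b ≤ qOpt K r l n z b + h := by
  cases b with
  | none =>
    simp only [qOpt]
    rw [add_mul, add_right_comm]
    exact add_le_add_right (mul_le_of_le_one_right' (hr1 n z)) _
  | some a =>
    refine (lintegral_mono fun x => vOpt_add_le K hr1 h _ _).trans ?_
    rw [lintegral_add_right _ measurable_const]
    simp [qOpt]

/-- Increments of the multiplier. -/
noncomputable def incr (k : ℕ) : ℝ≥0∞ := ((k : ℝ≥0∞) + 1)⁻¹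

theorem incr_ne_zero (k : ℕ) : incr k ≠ 0 := by
  simp [incr, ENNReal.add_eq_top]

theorem incr_ne_top (k : ℕ) : incr k ≠ ⊤ := by
  simp [incr]

theorem tendsto_incr : Tendsto incr atTop (nhds 0) := by
  have h := (tendsto_add_atTop_iff_nat 1).2 ENNReal.tendsto_inv_nat_nhds_zero
  simp only [Nat.cast_add, Nat.cast_one] at h
  exact h

/-- Difference quotients of the optimal value in the multiplier. -/
noncomputable def vQuot (K : (n : ℕ) → Kernel (Hist X A n × A) X)
    (r : (n : ℕ) → Hist X A n → ℝ≥0∞) (l : ℝ≥0∞) (k n : ℕ) (z : Hist X A n) : ℝ≥0∞ :=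
  (vOpt K r (l + incr k) n z - vOpt K r l n z) * (incr k)⁻¹

/-- The upper right derivative of the optimal value in the multiplier. -/
noncomputable def vDer (K : (n : ℕ) → Kernel (Hist X A n × A) X)
    (r : (n : ℕ) → Hist X A n → ℝ≥0∞) (l : ℝ≥0∞) (n : ℕ) (z : Hist X A n) : ℝ≥0∞ :=
  limsup (fun k => vQuot K r l k n z) atTop

/-- The terminal reward or the expected upper right derivative after a query. -/
noncomputable def qDer (K : (n : ℕ) → Kernel (Hist X A n × A) X)
    (r : (n : ℕ) → Hist X A n → ℝ≥0∞) (l : ℝ≥0∞) (n : ℕ) (z : Hist X A n) : Option A → ℝ≥0∞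
  | none => r n z
  | some a => ∫⁻ x, vDer K r l (n + 1) (z.snoc a x) ∂K n (z, a)

theorem measurable_vQuot (hr : ∀ n, Measurable (r n)) (l : ℝ≥0∞) (k n : ℕ) :
    Measurable (vQuot K r l k n) :=
  ((measurable_vOpt K hr _ n).sub (measurable_vOpt K hr _ n)).mul_const _

theorem measurable_vDer (hr : ∀ n, Measurable (r n)) (l : ℝ≥0∞) (n : ℕ) :
    Measurable (vDer K r l n) :=
  Measurable.limsup fun k => measurable_vQuot K hr l k n

theorem measurable_qDer (hr : ∀ n, Measurable (r n)) (l : ℝ≥0∞) (n : ℕ) (b : Option A) :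
    Measurable fun z => qDer K r l n z b := by
  cases b with
  | none => exact hr n
  | some a => exact measurable_lintegral_snoc K (measurable_vDer K hr l (n + 1)) a

theorem vQuot_le_one (hr1 : ∀ n z, r n z ≤ 1) (k n : ℕ) (z : Hist X A n) :
    vQuot K r l k n z ≤ 1 := by
  rw [← ENNReal.mul_inv_cancel (incr_ne_zero k) (incr_ne_top k)]
  refine mul_le_mul_left ?_ _
  rw [tsub_le_iff_left]
  exact vOpt_add_le K hr1 _ n z

theorem vDer_le_one (hr1 : ∀ n z, r n z ≤ 1) (n : ℕ) (z : Hist X A n) : vDer K r l n z ≤ 1 :=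
  limsup_le_of_le (h := Eventually.of_forall fun k => vQuot_le_one K hr1 k n z)

theorem lintegral_vQuot (hr : ∀ n, Measurable (r n)) (hr1 : ∀ n z, r n z ≤ 1) (hl : l ≠ ⊤)
    (k : ℕ) {n : ℕ} {β : Type*} [MeasurableSpace β] (ν : Measure β) [IsFiniteMeasure ν]
    {g : β → Hist X A n} (hg : Measurable g) :
    ∫⁻ y, vQuot K r l k n (g y) ∂ν =
      (∫⁻ y, vOpt K r (l + incr k) n (g y) ∂ν - ∫⁻ y, vOpt K r l n (g y) ∂ν) * (incr k)⁻¹ := by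
  have h1 : Measurable fun y => vOpt K r l n (g y) := (measurable_vOpt K hr _ n).comp hg
  have h2 : Measurable fun y => vOpt K r (l + incr k) n (g y) :=
    (measurable_vOpt K hr _ n).comp hg
  simp only [vQuot]
  rw [lintegral_mul_const _ (show Measurable fun y => vOpt K r (l + incr k) n (g y) -
    vOpt K r l n (g y) from h2.sub h1), lintegral_sub h1 _
    (Eventually.of_forall fun y => vOpt_mono K le_self_add _ _)]
  refine ne_top_of_le_ne_top ?_ (lintegral_mono fun y => vOpt_le K hr1 _ _)
  rw [lintegral_const]
  exact ENNReal.mul_ne_top hl (measure_ne_top _ _)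

/-- Reverse Fatou, the quotients being dominated by `1`. Its direction is the reason for defining
`vDer` as a limsup. -/
theorem limsup_lintegral_vQuot_le (hr : ∀ n, Measurable (r n)) (hr1 : ∀ n z, r n z ≤ 1)
    {n : ℕ} {β : Type*} [MeasurableSpace β] (ν : Measure β) [IsFiniteMeasure ν]
    {g : β → Hist X A n} (hg : Measurable g) :
    limsup (fun k => ∫⁻ y, vQuot K r l k n (g y) ∂ν) atTop ≤ ∫⁻ y, vDer K r l n (g y) ∂ν := by
  refine limsup_lintegral_le (fun _ => 1) (fun k => (measurable_vQuot K hr l k n).comp hg)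
    (fun k => Eventually.of_forall fun y => vQuot_le_one K hr1 k n (g y)) ?_
  simp

theorem measurable_snoc_right {n : ℕ} (z : Hist X A n) (a : A) :
    Measurable fun x : X => z.snoc a x :=
  (measurable_snoc a).comp (measurable_const.prodMk measurable_id)

/-- Some action of maximal value has at least the upper right derivative of the optimal value. -/
theorem exists_vDer_le_qDer (hr : ∀ n, Measurable (r n)) (hr1 : ∀ n z, r n z ≤ 1) (hl : l ≠ ⊤)
    (n : ℕ) (z : Hist X A n) :
    ∃ b, qOpt K r l n z b = vOpt K r l n z + 1 ∧ vDer K r l n z ≤ qDer K r l n z b := by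
  classical
  set dq : Option A → ℕ → ℝ≥0∞ := fun b k =>
    (qOpt K r (l + incr k) n z b - qOpt K r l n z b) * (incr k)⁻¹ with hdq
  set S : Finset (Option A) :=
    Finset.univ.filter fun b => qOpt K r l n z b = vOpt K r l n z + 1 with hS
  have hne : S.Nonempty := by
    obtain ⟨b, hb⟩ := exists_qOpt_eq K (l := l) hr n z
    exact ⟨b, by simpa [hS] using hb⟩
  -- Each nonmaximal action has a strict gap to the maximum. There are finitely many of them, so
  -- small increments stay below all gaps.
  have hev : ∀ᶠ k in atTop, ∀ b, b ∉ S → qOpt K r l n z b + incr k < vOpt K r l n z + 1 := by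
    refine eventually_all.2 fun b => ?_
    by_cases hb : b ∈ S
    · simp [hb]
    · have hlt : qOpt K r l n z b + 0 < vOpt K r l n z + 1 := by
        rw [add_zero]
        exact lt_of_le_of_ne (qOpt_le K hr n z b) (by simpa [hS] using hb)
      filter_upwards [(tendsto_const_nhds.add tendsto_incr).eventually_lt_const hlt] with k hk _
      exact hk
  -- An action maximal at `l + incr k` is then maximal at `l` too: any other would still fall short
  -- of the optimal value at `l`. The quotient of the value is thus the quotient of one action in
  -- `S`.
  have hle : ∀ᶠ k in atTop, vQuot K r l k n z ≤ S.sup fun b => dq b k := by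
    filter_upwards [hev] with k hk
    obtain ⟨b, hb⟩ := exists_qOpt_eq K (l := l + incr k) hr n z
    have hbS : b ∈ S := by
      by_contra hbS
      have h1 := (qOpt_add_le K (l := l) hr1 (incr k) n z b).trans_lt (hk b hbS)
      rw [hb] at h1
      exact absurd h1 (not_lt.2 (add_le_add_left (vOpt_mono K le_self_add n z) 1))
    refine le_trans (le_of_eq ?_) (Finset.le_sup (f := fun b => dq b k) hbS)
    have hbS' : qOpt K r l n z b = vOpt K r l n z + 1 := by simpa [hS] using hbS
    simp only [hdq, vQuot]
    rw [hb, hbS', ENNReal.add_sub_add_eq_sub_right ENNReal.one_ne_top]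
  -- Stopping has reward linear in the multiplier with slope `r`; a query is handled by reverse
  -- Fatou.
  have hlim : ∀ b, limsup (dq b) atTop ≤ qDer K r l n z b := by
    intro b
    cases b with
    | none =>
      refine limsup_le_of_le (h := Eventually.of_forall fun k => le_of_eq ?_)
      simp only [hdq, qOpt, qDer]
      rw [ENNReal.add_sub_add_eq_sub_right ENNReal.one_ne_top, add_mul,
        ENNReal.add_sub_cancel_left (ENNReal.mul_ne_top hl
          (ne_top_of_le_ne_top ENNReal.one_ne_top (hr1 n z))), mul_right_comm,
        ENNReal.mul_inv_cancel (incr_ne_zero k) (incr_ne_top k), one_mul]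
    | some a =>
      refine le_trans (le_of_eq ?_) (limsup_lintegral_vQuot_le K hr hr1 (K n (z, a))
        (measurable_snoc_right z a))
      congr 1
      ext k
      rw [lintegral_vQuot K hr hr1 hl k (K n (z, a)) (measurable_snoc_right z a)]
      rfl
  obtain ⟨b, hb, hmax⟩ := Finset.exists_mem_eq_sup S hne (qDer K r l n z)
  refine ⟨b, by simpa [hS] using hb, ?_⟩
  rw [← hmax]
  -- The limsup of a finite maximum is the maximum of the limsups, and this is attained at the
  -- chosen `b`.
  refine (limsup_le_limsup hle).trans ?_
  rw [limsup_finset_sup]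
  exact Finset.sup_mono_fun fun b _ => hlim b

/-- There is a deterministic policy that only plays actions of maximal value and whose expected
reward dominates the upper right derivative of the optimal value. -/
theorem exists_playsOptimal (hr : ∀ n, Measurable (r n)) (hr1 : ∀ n z, r n z ≤ 1) (hl : l ≠ ⊤) :
    ∃ π : Policy X A, (∀ n z, ∃ a, π.prob n z a = 1) ∧ PlaysOptimal K r l π ∧
      ∀ n z b, π.prob n z b ≠ 0 → vDer K r l n z ≤ qDer K r l n z b := by
  classical
  -- The score maximizes `qDer` among the actions of maximal value; the added `1` keeps such an
  -- action ahead of all others even when its `qDer` is `0`.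
  have hsel : ∀ n, ∃ f : Hist X A n → Option A, (∀ b, MeasurableSet {z | f z = b}) ∧
      ∀ z b, (if qOpt K r l n z b = vOpt K r l n z + 1 then 1 + qDer K r l n z b else 0) ≤
        if qOpt K r l n z (f z) = vOpt K r l n z + 1 then 1 + qDer K r l n z (f z) else 0 := by
    intro n
    refine exists_measurable_argmax (fun b z =>
      if qOpt K r l n z b = vOpt K r l n z + 1 then 1 + qDer K r l n z b else 0) fun b => ?_
    exact Measurable.ite (measurableSet_eq_fun (measurable_qOpt K hr l n b)
      ((measurable_vOpt K hr l n).add_const 1))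
      ((measurable_qDer K hr l n b).const_add 1) measurable_const
  choose f hf hmax using hsel
  have hgood : ∀ n z, qOpt K r l n z (f n z) = vOpt K r l n z + 1 ∧
      vDer K r l n z ≤ qDer K r l n z (f n z) := by
    intro n z
    obtain ⟨b, hb, hd⟩ := exists_vDer_le_qDer K hr hr1 hl n z
    have h := hmax n z b
    rw [if_pos hb] at h
    by_cases hq : qOpt K r l n z (f n z) = vOpt K r l n z + 1
    · rw [if_pos hq] at h
      exact ⟨hq, hd.trans ((ENNReal.add_le_add_iff_left ENNReal.one_ne_top).1 h)⟩
    · rw [if_neg hq] at h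
      simp at h
  have hprob : ∀ n z b, (Policy.ofSelection f hf).prob n z b ≠ 0 → b = f n z := by
    intro n z b h
    by_contra hb
    exact h (if_neg (Ne.symm hb))
  refine ⟨Policy.ofSelection f hf, fun n z => ⟨f n z, if_pos rfl⟩, fun n z b h => ?_,
    fun n z b h => ?_⟩
  · rw [hprob n z b h]
    exact (hgood n z).1
  · rw [hprob n z b h]
    exact (hgood n z).2

/-- Along this policy `vDer` is a subharmonic potential without cost, bounded by `1`, and where the
policy stops it is at most `r`. The run stops in integrable time because the policy plays optimally.
-/
theorem lintegral_vDer_le {π : Policy X A} (hr : ∀ n, Measurable (r n))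
    (hr1 : ∀ n z, r n z ≤ 1) (hl : l ≠ ⊤) (hπ : PlaysOptimal K r l π)
    (hd : ∀ n z b, π.prob n z b ≠ 0 → vDer K r l n z ≤ qDer K r l n z b)
    {n : ℕ} (μ : Measure (Hist X A n)) [IsProbabilityMeasure μ] :
    ∫⁻ z, vDer K r l n z ∂μ ≤ ∫⁻ o, r o.1 o.2 ∂stoppedLaw K π n μ := by
  have h := lintegral_add_le_of_subharmonic K π μ (G := vDer K r l) (f := r)
    (measurable_vDer K hr l) hr ENNReal.zero_ne_top ENNReal.one_ne_top (vDer_le_one K hr1)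
    (ne_top_of_le_ne_top hl (hπ.expQueries_le K μ hr hr1)) (fun n z => ?_)
  · simpa using h
  · have h1 : vDer K r l n z = ∑ b, π.prob n z b * vDer K r l n z := by
      rw [← Finset.sum_mul, π.sum_prob, one_mul]
    rw [zero_mul, add_zero, h1, Fintype.sum_option]
    have h2 : ∀ b, π.prob n z b * vDer K r l n z ≤ π.prob n z b * qDer K r l n z b := by
      intro b
      by_cases h : π.prob n z b = 0
      · simp [h]
      · exact mul_le_mul_right (hd n z b h) _
    exact add_le_add (h2 none) (Finset.sum_le_sum fun a _ => h2 (some a))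

/-- Turns a lower bound `d` on all integrated right slopes into one on the integrated derivative,
again by reverse Fatou. -/
theorem le_lintegral_vDer (hr : ∀ n, Measurable (r n)) (hr1 : ∀ n z, r n z ≤ 1) (hl : l ≠ ⊤)
    {n : ℕ} (μ : Measure (Hist X A n)) [IsProbabilityMeasure μ] {d : ℝ≥0∞}
    (hd : ∀ k, ∫⁻ z, vOpt K r l n z ∂μ + d * incr k ≤ ∫⁻ z, vOpt K r (l + incr k) n z ∂μ) :
    d ≤ ∫⁻ z, vDer K r l n z ∂μ := by
  refine le_trans ?_ (limsup_lintegral_vQuot_le K hr hr1 μ measurable_id)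
  refine le_trans (le_of_eq (limsup_const d).symm) (limsup_le_limsup
    (Eventually.of_forall fun k => ?_))
  change d ≤ ∫⁻ z, vQuot K r l k n (id z) ∂μ
  rw [lintegral_vQuot K hr hr1 hl k μ measurable_id, ← div_eq_mul_inv,
    ENNReal.le_div_iff_mul_le (Or.inl (incr_ne_zero k)) (Or.inl (incr_ne_top k))]
  refine ENNReal.le_sub_of_add_le_left (ne_top_of_le_ne_top hl ?_) (hd k)
  refine (lintegral_mono fun y => vOpt_le K hr1 _ _).trans ?_
  simp

end Derivative

section Posterior

variable {Ω X A 𝓗 : Type*} [MetricSpace Ω] [CompactSpace Ω] [MeasurableSpace Ω] [BorelSpace Ω]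
  [MetricSpace X] [CompactSpace X] [MeasurableSpace X] [BorelSpace X]
  [Fintype A] [TopologicalSpace A] [DiscreteTopology A] [MeasurableSpace A]
  [DiscreteMeasurableSpace A]
  [Fintype 𝓗] [MeasurableSpace 𝓗] [DiscreteMeasurableSpace 𝓗]

/-! ### Disintegration of the law of the interaction -/

theorem measurable_histZero : Measurable fun x : X => ((x, Fin.elim0) : Hist X A 0) :=
  measurable_id.prodMk measurable_const

namespace Model

variable (M : Model Ω X A 𝓗)

instance : IsProbabilityMeasure M.prior := M.isProbabilityMeasure_prior

instance : IsMarkovKernel M.init := M.isMarkovKernel_init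

instance (n : ℕ) : IsMarkovKernel (M.trans n) := M.isMarkovKernel_trans n

/-- The law of the first observation, averaged over the prior. -/
noncomputable def initLaw : Measure (Hist X A 0) :=
  (M.prior.bind M.init).map fun x => ((x, Fin.elim0) : Hist X A 0)

instance : IsProbabilityMeasure M.initLaw :=
  Measure.isProbabilityMeasure_map measurable_histZero.aemeasurable

/-- The law of the first observation under a fixed environment. -/
noncomputable def envInit (ω : Ω) : Measure (Hist X A 0) :=
  (M.init ω).map fun x => ((x, Fin.elim0) : Hist X A 0)

instance (ω : Ω) : IsProbabilityMeasure (M.envInit ω) :=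
  Measure.isProbabilityMeasure_map measurable_histZero.aemeasurable

end Model

namespace Model.Domination

variable {M : Model Ω X A 𝓗} (D : M.Domination)

instance : IsProbabilityMeasure D.base := D.isProbabilityMeasure_base

instance : IsProbabilityMeasure D.base₀ := D.isProbabilityMeasure_base₀

theorem measurable_evidence (n : ℕ) : Measurable (D.evidence n) :=
  (D.measurable_likelihood n).lintegral_prod_right'

theorem measurable_likelihood_left (n : ℕ) (z : Hist X A n) :
    Measurable fun ω => D.likelihood n ω z :=
  (D.measurable_likelihood n).comp (measurable_const.prodMk measurable_id)

theorem measurable_likelihood_right (n : ℕ) (ω : Ω) :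
    Measurable fun z => D.likelihood n ω z :=
  (D.measurable_likelihood n).comp (measurable_id.prodMk measurable_const)

theorem measurable_dens_right (n : ℕ) (p : Ω × Hist X A n × A) : Measurable (D.dens n p) :=
  (D.measurable_dens n).comp (measurable_const.prodMk measurable_id)

theorem likelihood_snoc (n : ℕ) (ω : Ω) (z : Hist X A n) (a : A) (x : X) :
    D.likelihood (n + 1) ω (z.snoc a x) = D.likelihood n ω z * D.dens n (ω, z, a) x := by
  rw [likelihood, Hist.init_snoc, Hist.snoc_last]

instance (n : ℕ) : IsMarkovKernel (D.posterior n) := by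
  refine ⟨fun z => ?_⟩
  change IsProbabilityMeasure (ite _ _ _)
  split_ifs with h
  · infer_instance
  · push Not at h
    refine ⟨?_⟩
    rw [Measure.smul_apply, withDensity_apply _ MeasurableSet.univ, Measure.restrict_univ,
      smul_eq_mul]
    exact ENNReal.inv_mul_cancel h.1 h.2

instance (n : ℕ) : IsMarkovKernel (D.predictive n) := by
  unfold predictive
  infer_instance

theorem lintegral_trans (n : ℕ) (p : Ω × Hist X A n × A) {f : X → ℝ≥0∞} (hf : Measurable f) :
    ∫⁻ x, f x ∂M.trans n p = ∫⁻ x, D.dens n p x * f x ∂D.base := by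
  rw [D.trans_eq]
  exact lintegral_withDensity_eq_lintegral_mul _ (D.measurable_dens_right n p) hf

theorem lintegral_predictive (n : ℕ) (z : Hist X A n) (a : A) {f : X → ℝ≥0∞}
    (hf : Measurable f) :
    ∫⁻ x, f x ∂D.predictive n (z, a) =
      ∫⁻ ω, ∫⁻ x, f x ∂M.trans n (ω, z, a) ∂D.posterior n z := by
  rw [predictive, Kernel.lintegral_comp _ _ _ hf, Kernel.lintegral_prod _ _ _ hf.lintegral_kernel]
  refine lintegral_congr fun ω => ?_
  rw [Kernel.id_apply, lintegral_dirac']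
  exact hf.lintegral_kernel.comp (measurable_const.prodMk measurable_id)

/-- Bayes' rule. -/
theorem evidence_mul_lintegral_posterior (n : ℕ) (z : Hist X A n) (hz : D.evidence n z ≠ ⊤)
    {g : Ω → ℝ≥0∞} (hg : Measurable g) :
    D.evidence n z * ∫⁻ ω, g ω ∂D.posterior n z = ∫⁻ ω, D.likelihood n ω z * g ω ∂M.prior := by
  by_cases h0 : D.evidence n z = 0
  -- Here the posterior is the prior by convention, but the likelihood vanishes almost everywhere,
  -- so both sides are `0`.
  · rw [h0, zero_mul]
    have h1 := (lintegral_eq_zero_iff (D.measurable_likelihood_left n z)).1 h0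
    symm
    rw [lintegral_eq_zero_iff (show Measurable fun ω => D.likelihood n ω z * g ω from
      (D.measurable_likelihood_left n z).mul hg)]
    filter_upwards [h1] with ω hω
    simp_all
  · have h1 : D.posterior n z =
        (D.evidence n z)⁻¹ • M.prior.withDensity fun ω => D.likelihood n ω z :=
      if_neg (by simp [h0, hz])
    rw [h1, lintegral_smul_measure, smul_eq_mul, ← mul_assoc, ENNReal.mul_inv_cancel h0 hz,
      one_mul]
    exact lintegral_withDensity_eq_lintegral_mul _ (D.measurable_likelihood_left n z) hg

/-- The run in which all observations are drawn from the dominating measures. -/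
noncomputable def baseRun (π : Policy X A) (k : ℕ) : Measure (Hist X A (0 + k)) :=
  runLaw (fun _ => Kernel.const _ D.base) π 0
    (D.base₀.map fun x => ((x, Fin.elim0) : Hist X A 0)) k

instance (π : Policy X A) (k : ℕ) : IsFiniteMeasure (D.baseRun π k) := by
  unfold baseRun
  infer_instance

variable (π : Policy X A)

theorem lintegral_baseRun_succ (k : ℕ) {f : Hist X A (0 + k + 1) → ℝ≥0∞} (hf : Measurable f) :
    ∫⁻ z, f z ∂D.baseRun π (k + 1) =
      ∫⁻ z, ∑ a, π.prob (0 + k) z (some a) * ∫⁻ x, f (z.snoc a x) ∂D.base ∂D.baseRun π k :=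
  lintegral_runLaw_succ (fun _ => Kernel.const _ D.base) π _ k hf

/-- The law of a run under `ω` has the likelihood as its density. -/
theorem lintegral_runLaw_env (ω : Ω) (k : ℕ) {f : Hist X A (0 + k) → ℝ≥0∞} (hf : Measurable f) :
    ∫⁻ z, f z ∂runLaw (fun n => (M.trans n).sectR ω) π 0 (M.envInit ω) k =
      ∫⁻ z, D.likelihood (0 + k) ω z * f z ∂D.baseRun π k := by
  induction k with
  | zero =>
    have hm : Measurable fun z => D.likelihood 0 ω z * f z :=
      (D.measurable_likelihood_right 0 ω).mul hf
    change ∫⁻ z, f z ∂M.envInit ω = ∫⁻ z, D.likelihood 0 ω z * f z ∂(D.base₀.map _)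
    rw [lintegral_map hm measurable_histZero, Model.envInit]
    refine (lintegral_map hf measurable_histZero).trans ?_
    rw [D.init_eq]
    exact lintegral_withDensity_eq_lintegral_mul _
      (D.measurable_dens₀.comp (measurable_const.prodMk measurable_id))
      (hf.comp measurable_histZero)
  | succ k ih =>
    have hm : Measurable fun z => D.likelihood (0 + k + 1) ω z * f z :=
      (D.measurable_likelihood_right _ ω).mul hf
    have h1 : Measurable fun z : Hist X A (0 + k) => ∑ a, π.prob (0 + k) z (some a) *
        ∫⁻ x, f (z.snoc a x) ∂(M.trans (0 + k)).sectR ω (z, a) :=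
      Finset.measurable_sum _ fun a _ => (π.measurable_prob _ _).mul
        (measurable_lintegral_snoc (fun n => (M.trans n).sectR ω) hf a)
    refine (lintegral_runLaw_succ (fun n => (M.trans n).sectR ω) π (M.envInit ω) k hf).trans ?_
    rw [ih h1]
    refine Eq.trans ?_ (D.lintegral_baseRun_succ π k hm).symm
    refine lintegral_congr fun z => ?_
    rw [Finset.mul_sum]
    refine Finset.sum_congr rfl fun a _ => ?_
    have hfz : Measurable fun x => f (z.snoc a x) := hf.comp (measurable_snoc_right z a)
    have hdf : Measurable fun x => D.dens (0 + k) (ω, z, a) x * f (z.snoc a x) :=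
      (D.measurable_dens_right _ _).mul hfz
    rw [Kernel.sectR_apply, D.lintegral_trans _ _ hfz, mul_left_comm, ← lintegral_const_mul _ hdf]
    congr 1
    refine lintegral_congr fun x => ?_
    rw [D.likelihood_snoc, mul_assoc]

/-- By Tonelli the evidence integrates to the prior average of the masses of the runs under `ω`,
hence to at most `1`. This makes Bayes' rule available almost everywhere on the reference run. -/
theorem ae_evidence_ne_top (k : ℕ) : ∀ᵐ z ∂D.baseRun π k, D.evidence (0 + k) z ≠ ⊤ := by
  have h : ∫⁻ z, D.evidence (0 + k) z ∂D.baseRun π k ≠ ⊤ := by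
    simp only [evidence]
    rw [lintegral_lintegral_swap (D.measurable_likelihood (0 + k)).aemeasurable]
    refine ne_top_of_le_ne_top ENNReal.one_ne_top ?_
    calc ∫⁻ ω, ∫⁻ z, D.likelihood (0 + k) ω z ∂D.baseRun π k ∂M.prior ≤ ∫⁻ _, 1 ∂M.prior := by
          refine lintegral_mono fun ω => ?_
          have h1 := D.lintegral_runLaw_env π ω k (f := fun _ => 1) measurable_const
          simp only [mul_one, lintegral_one] at h1
          rw [← h1]
          exact runLaw_univ_le _ π _ k
      _ = 1 := by simp
  filter_upwards [ae_lt_top (D.measurable_evidence _) h] with z hz using hz.ne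

/-- The law of a run with predictive observations has the evidence as its density. -/
theorem lintegral_runLaw_predictive (k : ℕ) {f : Hist X A (0 + k) → ℝ≥0∞} (hf : Measurable f) :
    ∫⁻ z, f z ∂runLaw D.predictive π 0 M.initLaw k =
      ∫⁻ z, D.evidence (0 + k) z * f z ∂D.baseRun π k := by
  induction k with
  | zero =>
    have hm : Measurable fun z => D.evidence 0 z * f z := (D.measurable_evidence 0).mul hf
    have hfx : Measurable fun x : X => f (x, Fin.elim0) := hf.comp measurable_histZero
    change ∫⁻ z, f z ∂M.initLaw = ∫⁻ z, D.evidence 0 z * f z ∂(D.base₀.map _)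
    rw [lintegral_map hm measurable_histZero, Model.initLaw]
    refine (lintegral_map hf measurable_histZero).trans ?_
    rw [Measure.lintegral_bind M.init.measurable.aemeasurable hfx.aemeasurable]
    have h1 : Measurable fun p : Ω × X => D.dens₀ p.1 p.2 * f (p.2, Fin.elim0) :=
      D.measurable_dens₀.mul (hfx.comp measurable_snd)
    calc ∫⁻ ω, ∫⁻ x, f (x, Fin.elim0) ∂M.init ω ∂M.prior
        = ∫⁻ ω, ∫⁻ x, D.dens₀ ω x * f (x, Fin.elim0) ∂D.base₀ ∂M.prior := by
          refine lintegral_congr fun ω => ?_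
          rw [D.init_eq]
          exact lintegral_withDensity_eq_lintegral_mul _
            (D.measurable_dens₀.comp (measurable_const.prodMk measurable_id)) hfx
      _ = ∫⁻ x, ∫⁻ ω, D.dens₀ ω x * f (x, Fin.elim0) ∂M.prior ∂D.base₀ :=
          lintegral_lintegral_swap h1.aemeasurable
      _ = _ := by
          refine lintegral_congr fun x => ?_
          exact lintegral_mul_const _
            (D.measurable_dens₀.comp (measurable_id.prodMk measurable_const))
  | succ k ih =>
    have hm : Measurable fun z => D.evidence (0 + k + 1) z * f z :=
      (D.measurable_evidence _).mul hf
    have h1 : Measurable fun z : Hist X A (0 + k) => ∑ a, π.prob (0 + k) z (some a) *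
        ∫⁻ x, f (z.snoc a x) ∂D.predictive (0 + k) (z, a) :=
      Finset.measurable_sum _ fun a _ => (π.measurable_prob _ _).mul
        (measurable_lintegral_snoc D.predictive hf a)
    refine (lintegral_runLaw_succ D.predictive π M.initLaw k hf).trans ?_
    rw [ih h1]
    refine Eq.trans ?_ (D.lintegral_baseRun_succ π k hm).symm
    refine lintegral_congr_ae ?_
    filter_upwards [D.ae_evidence_ne_top π k] with z hz
    rw [Finset.mul_sum]
    refine Finset.sum_congr rfl fun a _ => ?_
    have hfz : Measurable fun x => f (z.snoc a x) := hf.comp (measurable_snoc_right z a)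
    have h2 : Measurable fun ω => ∫⁻ x, f (z.snoc a x) ∂M.trans (0 + k) (ω, z, a) :=
      hfz.lintegral_kernel.comp (measurable_id.prodMk measurable_const)
    have h3 : Measurable fun p : Ω × X =>
        D.likelihood (0 + k) p.1 z * (D.dens (0 + k) (p.1, z, a) p.2 * f (z.snoc a p.2)) :=
      ((D.measurable_likelihood_left _ z).comp measurable_fst).mul
        (((D.measurable_dens _).comp ((measurable_fst.prodMk measurable_const).prodMk
          measurable_snd)).mul (hfz.comp measurable_snd))
    -- Bayes' rule replaces evidence times posterior by likelihood times prior; Tonelli then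
    -- integrates the likelihood of the extended trajectory to its evidence.
    rw [D.lintegral_predictive _ _ _ hfz, mul_left_comm,
      D.evidence_mul_lintegral_posterior _ _ hz h2]
    congr 1
    calc ∫⁻ ω, D.likelihood (0 + k) ω z *
          ∫⁻ x, f (z.snoc a x) ∂M.trans (0 + k) (ω, z, a) ∂M.prior
        = ∫⁻ ω, ∫⁻ x, D.likelihood (0 + k) ω z *
            (D.dens (0 + k) (ω, z, a) x * f (z.snoc a x)) ∂D.base ∂M.prior := by
          refine lintegral_congr fun ω => ?_
          rw [D.lintegral_trans _ _ hfz]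
          exact (lintegral_const_mul _ ((D.measurable_dens_right _ _).mul hfz)).symm
      _ = ∫⁻ x, ∫⁻ ω, D.likelihood (0 + k) ω z *
            (D.dens (0 + k) (ω, z, a) x * f (z.snoc a x)) ∂M.prior ∂D.base :=
          lintegral_lintegral_swap h3.aemeasurable
      _ = _ := by
          refine lintegral_congr fun x => ?_
          rw [evidence, ← lintegral_mul_const _ (D.measurable_likelihood_left _ _)]
          refine lintegral_congr fun ω => ?_
          rw [D.likelihood_snoc, mul_assoc]

theorem lintegral_dirac_prod_stoppedLaw (ω : Ω) {f : Ω × Traj X A → ℝ≥0∞} (hf : Measurable f) :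
    ∫⁻ p, f p ∂((Measure.dirac ω).prod
        (stoppedLaw (fun n => (M.trans n).sectR ω) π 0 (M.envInit ω))) =
      ∑' k, ∫⁻ z, D.likelihood (0 + k) ω z * (π.prob (0 + k) z none * f (ω, ⟨0 + k, z⟩))
        ∂D.baseRun π k := by
  have hω : Measurable fun t => f (ω, t) := hf.comp (measurable_const.prodMk measurable_id)
  rw [lintegral_prod _ hf.aemeasurable, lintegral_dirac' _ hf.lintegral_prod_right',
    lintegral_stoppedLaw _ π _ hω]
  refine tsum_congr fun k => ?_
  rw [D.lintegral_runLaw_env π ω k]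
  exact (π.measurable_prob _ _).mul (hω.comp (measurable_trajMk _))

theorem measurable_likelihood_mul (k : ℕ) {f : Ω × Traj X A → ℝ≥0∞} (hf : Measurable f) :
    Measurable fun p : Ω × Hist X A (0 + k) =>
      D.likelihood (0 + k) p.1 p.2 * (π.prob (0 + k) p.2 none * f (p.1, ⟨0 + k, p.2⟩)) :=
  ((D.measurable_likelihood _).comp measurable_swap).mul
    (((π.measurable_prob _ _).comp measurable_snd).mul
      (hf.comp (measurable_fst.prodMk ((measurable_trajMk _).comp measurable_snd))))

/-- Needed to integrate against the `bind` in `pathLaw`. The kernels of the run vary with `ω`, but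
the density formula rewrites everything over a reference run free of `ω`, with jointly measurable
integrands. -/
theorem measurable_dirac_prod_stoppedLaw (D : M.Domination) :
    Measurable fun ω => (Measure.dirac ω).prod
      (stoppedLaw (fun n => (M.trans n).sectR ω) π 0 (M.envInit ω)) := by
  refine Measure.measurable_of_measurable_coe _ fun s hs => ?_
  have hs' : Measurable (s.indicator (1 : Ω × Traj X A → ℝ≥0∞)) :=
    measurable_one.indicator hs
  simp_rw [← lintegral_indicator_one hs, D.lintegral_dirac_prod_stoppedLaw π _ hs']
  exact Measurable.tsum fun k => (D.measurable_likelihood_mul π k hs').lintegral_prod_right'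

/-- The law of the trajectory `D_τ`, averaged over the prior. -/
noncomputable def trajLaw : Measure (Traj X A) := stoppedLaw D.predictive π 0 M.initLaw

theorem measurable_lintegral_posterior {f : Ω × Traj X A → ℝ≥0∞} (hf : Measurable f) :
    Measurable fun t : Traj X A => ∫⁻ ω, f (ω, t) ∂D.posterior t.1 t.2 :=
  measurable_traj fun n => Measurable.lintegral_kernel_prod_right (κ := D.posterior n)
    (f := fun z ω => f (ω, ⟨n, z⟩))
    (hf.comp (measurable_snd.prodMk ((measurable_trajMk n).comp measurable_fst)))

/-- The posterior is the conditional law of the environment given the stopped trajectory. -/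
theorem lintegral_pathLaw {f : Ω × Traj X A → ℝ≥0∞} (hf : Measurable f) :
    ∫⁻ p, f p ∂M.pathLaw π =
      ∫⁻ t, ∫⁻ ω, f (ω, t) ∂D.posterior t.1 t.2 ∂D.trajLaw π := by
  have hpath : M.pathLaw π = M.prior.bind fun ω => (Measure.dirac ω).prod
      (stoppedLaw (fun n => (M.trans n).sectR ω) π 0 (M.envInit ω)) := rfl
  have hpost := D.measurable_lintegral_posterior hf
  rw [hpath, Measure.lintegral_bind (measurable_dirac_prod_stoppedLaw π D).aemeasurable
    hf.aemeasurable, trajLaw, lintegral_stoppedLaw _ π _ hpost]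
  simp_rw [D.lintegral_dirac_prod_stoppedLaw π _ hf]
  rw [lintegral_tsum fun k =>
    (D.measurable_likelihood_mul π k hf).lintegral_prod_right'.aemeasurable]
  refine tsum_congr fun k => ?_
  have hm : Measurable fun z : Hist X A (0 + k) =>
      π.prob (0 + k) z none * ∫⁻ ω, f (ω, ⟨0 + k, z⟩) ∂D.posterior (0 + k) z :=
    (π.measurable_prob _ _).mul (hpost.comp (measurable_trajMk _))
  rw [D.lintegral_runLaw_predictive π k hm,
    lintegral_lintegral_swap (D.measurable_likelihood_mul π k hf).aemeasurable]
  refine lintegral_congr_ae ?_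
  filter_upwards [D.ae_evidence_ne_top π k] with z hz
  have hfz : Measurable fun ω => f (ω, (⟨0 + k, z⟩ : Traj X A)) :=
    hf.comp (measurable_id.prodMk measurable_const)
  have hLf : Measurable fun ω => D.likelihood (0 + k) ω z * f (ω, (⟨0 + k, z⟩ : Traj X A)) :=
    (D.measurable_likelihood_left _ _).mul hfz
  rw [mul_left_comm, D.evidence_mul_lintegral_posterior _ _ hz hfz, ← lintegral_const_mul _ hLf]
  exact lintegral_congr fun ω => mul_left_comm _ _ _

end Model.Domination

end Posterior

section Theorem

variable {Ω X A 𝓗 : Type*} [MetricSpace Ω] [CompactSpace Ω] [MeasurableSpace Ω] [BorelSpace Ω]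
  [MetricSpace X] [CompactSpace X] [MeasurableSpace X] [BorelSpace X]
  [Fintype A] [TopologicalSpace A] [DiscreteTopology A] [MeasurableSpace A]
  [DiscreteMeasurableSpace A]
  [Fintype 𝓗] [MeasurableSpace 𝓗] [DiscreteMeasurableSpace 𝓗]

theorem neg_coe_add_coe {E : ℝ≥0∞} (hE : E ≠ ⊤) (x : ℝ) :
    -(E : EReal) + (x : EReal) = ((x - E.toReal : ℝ) : EReal) := by
  rw [← EReal.coe_ennreal_toReal hE, ← EReal.coe_neg, ← EReal.coe_add, neg_add_eq_sub]

theorem neg_coe_add_coe_le {E : ℝ≥0∞} {x y : ℝ} (h : E ≠ ⊤ → x - E.toReal ≤ y) :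
    -(E : EReal) + (x : EReal) ≤ (y : EReal) := by
  by_cases hE : E = ⊤
  · simp [hE]
  · rw [neg_coe_add_coe hE]
    exact EReal.coe_le_coe_iff.2 (h hE)

namespace Model.Domination

variable {M : Model Ω X A 𝓗} (D : M.Domination)

/-! ### The maximal posterior probability as a reward -/

/-- `r(z)` as an extended nonnegative number. -/
noncomputable def reward (n : ℕ) (z : Hist X A n) : ℝ≥0∞ :=
  ⨆ H : 𝓗, D.posterior n z (M.truth ⁻¹' {H})

theorem measurable_posterior_truth (n : ℕ) (H : 𝓗) :
    Measurable fun z => D.posterior n z (M.truth ⁻¹' {H}) :=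
  Kernel.measurable_coe _ (M.measurable_truth (measurableSet_singleton H))

theorem measurable_reward (n : ℕ) : Measurable (D.reward n) :=
  Measurable.iSup fun H => D.measurable_posterior_truth n H

theorem reward_le_one (n : ℕ) (z : Hist X A n) : D.reward n z ≤ 1 :=
  iSup_le fun _ => prob_le_one

theorem reward_ne_top (n : ℕ) (z : Hist X A n) : D.reward n z ≠ ⊤ :=
  ne_top_of_le_ne_top ENNReal.one_ne_top (D.reward_le_one n z)

theorem toReal_reward (n : ℕ) (z : Hist X A n) : (D.reward n z).toReal = D.maxPosterior n z :=
  ENNReal.toReal_iSup fun _ => measure_ne_top _ _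

theorem integral_maxPosterior {β : Type*} [MeasurableSpace β] (ν : Measure β) {g : β → Traj X A}
    (hg : Measurable g) :
    ∫ y, D.maxPosterior (g y).1 (g y).2 ∂ν = (∫⁻ y, D.reward (g y).1 (g y).2 ∂ν).toReal := by
  simp_rw [← D.toReal_reward]
  refine integral_toReal ?_ (Eventually.of_forall fun y => (D.reward_ne_top _ _).lt_top)
  exact ((measurable_traj (f := fun o => D.reward o.1 o.2) D.measurable_reward).comp
    hg).aemeasurable

/-- The expected reward of a policy, from a given law of the trajectory at time `n`. -/
noncomputable def expReward (π : Policy X A) (n : ℕ) (μ : Measure (Hist X A n)) : ℝ≥0∞ :=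
  ∫⁻ o, D.reward o.1 o.2 ∂stoppedLaw D.predictive π n μ

section Bounds

variable (π : Policy X A) {n : ℕ} (μ : Measure (Hist X A n)) [IsProbabilityMeasure μ] {lam : ℝ}

theorem expReward_le_one : D.expReward π n μ ≤ 1 := by
  refine (lintegral_mono fun o : Traj X A => D.reward_le_one o.1 o.2).trans ?_
  rw [lintegral_one]
  exact stoppedLaw_univ_le _ π μ

theorem expReward_ne_top : D.expReward π n μ ≠ ⊤ :=
  ne_top_of_le_ne_top ENNReal.one_ne_top (D.expReward_le_one π μ)

theorem lintegral_vOpt_le (l : ℝ≥0∞) : ∫⁻ z, vOpt D.predictive D.reward l n z ∂μ ≤ l := by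
  refine (lintegral_mono fun z => vOpt_le D.predictive D.reward_le_one n z).trans ?_
  simp

theorem lintegral_vOpt_ne_top (lam : ℝ) :
    ∫⁻ z, vOpt D.predictive D.reward (ENNReal.ofReal lam) n z ∂μ ≠ ⊤ :=
  ne_top_of_le_ne_top ENNReal.ofReal_ne_top (D.lintegral_vOpt_le μ _)

theorem mul_expReward_le (hlam : 0 ≤ lam) (hE : expQueries D.predictive π n μ ≠ ⊤) :
    lam * (D.expReward π n μ).toReal - (expQueries D.predictive π n μ).toReal ≤
      (∫⁻ z, vOpt D.predictive D.reward (ENNReal.ofReal lam) n z ∂μ).toReal := by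
  have h := reward_le_vOpt_add_expQueries D.predictive (l := ENNReal.ofReal lam) π μ
    D.measurable_reward
  have hV := D.lintegral_vOpt_ne_top μ lam
  have h' := ENNReal.toReal_mono (ENNReal.add_ne_top.2 ⟨hV, hE⟩) h
  rw [ENNReal.toReal_mul, ENNReal.toReal_ofReal hlam, ENNReal.toReal_add hV hE] at h'
  exact sub_le_iff_le_add.2 h'

variable {π}

theorem expQueries_ne_top
    (hπ : PlaysOptimal D.predictive D.reward (ENNReal.ofReal lam) π) :
    expQueries D.predictive π n μ ≠ ⊤ :=
  ne_top_of_le_ne_top ENNReal.ofReal_ne_top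
    (hπ.expQueries_le D.predictive μ D.measurable_reward D.reward_le_one)

theorem mul_expReward_eq (hlam : 0 ≤ lam)
    (hπ : PlaysOptimal D.predictive D.reward (ENNReal.ofReal lam) π) :
    lam * (D.expReward π n μ).toReal - (expQueries D.predictive π n μ).toReal =
      (∫⁻ z, vOpt D.predictive D.reward (ENNReal.ofReal lam) n z ∂μ).toReal := by
  have h := hπ.reward_eq D.predictive μ D.measurable_reward D.reward_le_one ENNReal.ofReal_ne_top
  have hV := D.lintegral_vOpt_ne_top μ lam
  have h' := congrArg ENNReal.toReal h
  rw [ENNReal.toReal_mul, ENNReal.toReal_ofReal hlam,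
    ENNReal.toReal_add hV (D.expQueries_ne_top μ hπ)] at h'
  exact sub_eq_iff_eq_add.2 h'

end Bounds

/-! ### Values and action values -/

theorem exists_playsOptimal_predictive (lam : ℝ) :
    ∃ π : Policy X A, (∀ n z, ∃ a, π.prob n z a = 1) ∧
      PlaysOptimal D.predictive D.reward (ENNReal.ofReal lam) π ∧
      ∀ n z b, π.prob n z b ≠ 0 →
        vDer D.predictive D.reward (ENNReal.ofReal lam) n z ≤
          qDer D.predictive D.reward (ENNReal.ofReal lam) n z b :=
  exists_playsOptimal D.predictive D.measurable_reward D.reward_le_one ENNReal.ofReal_ne_top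

variable {lam : ℝ}

theorem policyValue_eq (n : ℕ) (z : Hist X A n) (π : Policy X A) :
    D.policyValue lam n z π =
      -(expQueries D.predictive π n (Measure.dirac z) : EReal) +
        ((lam * (D.expReward π n (Measure.dirac z)).toReal : ℝ) : EReal) := by
  rw [policyValue, expRemaining, condLaw, lintegral_length_stoppedLaw,
    D.integral_maxPosterior _ (g := fun o => o) measurable_id]
  rfl

/-- Verification from the Dirac law at `z`: `vOpt` bounds every policy and is attained by one that
plays optimally. The supremum is therefore finite and `toReal` in `value` loses nothing. -/
theorem value_eq (hlam : 0 ≤ lam) (n : ℕ) (z : Hist X A n) :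
    D.value lam n z = (vOpt D.predictive D.reward (ENNReal.ofReal lam) n z).toReal := by
  have hd : ∫⁻ y, vOpt D.predictive D.reward (ENNReal.ofReal lam) n y ∂Measure.dirac z =
      vOpt D.predictive D.reward (ENNReal.ofReal lam) n z :=
    lintegral_dirac' _ (measurable_vOpt _ D.measurable_reward _ n)
  have h : ⨆ π : Policy X A, D.policyValue lam n z π =
      ((vOpt D.predictive D.reward (ENNReal.ofReal lam) n z).toReal : EReal) := by
    apply le_antisymm
    · refine iSup_le fun π => ?_
      rw [D.policyValue_eq, ← hd]
      exact neg_coe_add_coe_le fun hE => D.mul_expReward_le π _ hlam hE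
    · obtain ⟨π, -, hπ, -⟩ := D.exists_playsOptimal_predictive lam
      refine le_trans (le_of_eq ?_) (le_iSup _ π)
      rw [D.policyValue_eq, neg_coe_add_coe (D.expQueries_ne_top _ hπ),
        D.mul_expReward_eq _ hlam hπ, hd]
  rw [value, h, EReal.toReal_coe]

theorem vOpt_ne_top (lam : ℝ) (n : ℕ) (z : Hist X A n) :
    vOpt D.predictive D.reward (ENNReal.ofReal lam) n z ≠ ⊤ :=
  ne_top_of_le_ne_top ENNReal.ofReal_ne_top (vOpt_le D.predictive D.reward_le_one n z)

theorem measurable_value (hlam : 0 ≤ lam) (n : ℕ) : Measurable (D.value lam n) := by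
  have : D.value lam n =
      fun z => (vOpt D.predictive D.reward (ENNReal.ofReal lam) n z).toReal :=
    funext fun z => D.value_eq hlam n z
  rw [this]
  exact (measurable_vOpt _ D.measurable_reward _ n).ennreal_toReal

theorem qOpt_ne_top (lam : ℝ) (n : ℕ) (z : Hist X A n) (b : Option A) :
    qOpt D.predictive D.reward (ENNReal.ofReal lam) n z b ≠ ⊤ :=
  ne_top_of_le_ne_top (ENNReal.add_ne_top.2 ⟨D.vOpt_ne_top lam n z, ENNReal.one_ne_top⟩)
    (qOpt_le D.predictive D.measurable_reward n z b)

theorem qValue_eq (hlam : 0 ≤ lam) (n : ℕ) (z : Hist X A n) (b : Option A) :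
    D.qValue lam n z b =
      (qOpt D.predictive D.reward (ENNReal.ofReal lam) n z b).toReal - 1 := by
  cases b with
  | none =>
    simp only [qValue, qOpt]
    rw [ENNReal.toReal_add (ENNReal.mul_ne_top ENNReal.ofReal_ne_top (D.reward_ne_top n z))
      ENNReal.one_ne_top, ENNReal.toReal_mul, ENNReal.toReal_ofReal hlam, D.toReal_reward]
    simp
  | some a =>
    simp only [qValue, qOpt, D.value_eq hlam]
    have hm : Measurable fun x =>
        vOpt D.predictive D.reward (ENNReal.ofReal lam) (n + 1) (z.snoc a x) :=
      (measurable_vOpt _ D.measurable_reward _ (n + 1)).comp (measurable_snoc_right z a)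
    rw [integral_toReal hm.aemeasurable
      (Eventually.of_forall fun x => (D.vOpt_ne_top lam _ _).lt_top)]
    ring

theorem iSup_qValue (hlam : 0 ≤ lam) (n : ℕ) (z : Hist X A n) :
    ⨆ b, D.qValue lam n z b = D.value lam n z := by
  have hadd : (vOpt D.predictive D.reward (ENNReal.ofReal lam) n z + 1).toReal =
      (vOpt D.predictive D.reward (ENNReal.ofReal lam) n z).toReal + 1 := by
    rw [ENNReal.toReal_add (D.vOpt_ne_top lam n z) ENNReal.one_ne_top, ENNReal.toReal_one]
  apply le_antisymm
  · refine ciSup_le fun b => ?_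
    rw [D.qValue_eq hlam, D.value_eq hlam, sub_le_iff_le_add, ← hadd]
    exact ENNReal.toReal_mono (ENNReal.add_ne_top.2 ⟨D.vOpt_ne_top lam n z, ENNReal.one_ne_top⟩)
      (qOpt_le D.predictive D.measurable_reward n z b)
  · obtain ⟨b, hb⟩ := exists_qOpt_eq D.predictive (l := ENNReal.ofReal lam) D.measurable_reward n z
    refine le_trans (le_of_eq ?_) (le_ciSup (Set.finite_range _).bddAbove b)
    rw [D.qValue_eq hlam, hb, hadd, D.value_eq hlam, add_sub_cancel_right]

theorem integrable_value (hlam : 0 ≤ lam) (n : ℕ) (z : Hist X A n) (a : A) :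
    Integrable (fun x => D.value lam (n + 1) (z.snoc a x)) (D.predictive n (z, a)) := by
  refine Integrable.of_bound ((D.measurable_value hlam (n + 1)).comp
    (measurable_snoc_right z a)).aestronglyMeasurable lam (Eventually.of_forall fun x => ?_)
  rw [D.value_eq hlam, Real.norm_of_nonneg ENNReal.toReal_nonneg]
  exact ENNReal.toReal_le_of_le_ofReal hlam (vOpt_le D.predictive D.reward_le_one _ _)

theorem isGreedy_iff (hlam : 0 ≤ lam) (π : Policy X A) :
    D.IsGreedy lam π ↔ PlaysOptimal D.predictive D.reward (ENNReal.ofReal lam) π := by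
  have hle : ∀ n z b a, D.qValue lam n z b ≤ D.qValue lam n z a ↔
      qOpt D.predictive D.reward (ENNReal.ofReal lam) n z b ≤
        qOpt D.predictive D.reward (ENNReal.ofReal lam) n z a := by
    intro n z b a
    rw [D.qValue_eq hlam, D.qValue_eq hlam, sub_le_sub_iff_right,
      ENNReal.toReal_le_toReal (D.qOpt_ne_top lam n z b) (D.qOpt_ne_top lam n z a)]
  simp only [IsGreedy, PlaysOptimal, hle]
  refine forall₄_congr fun n z a _ => ?_
  rw [vOpt_add_one D.predictive D.measurable_reward]
  constructor
  · exact fun h => le_antisymm (le_iSup (qOpt D.predictive D.reward _ n z) a) (iSup_le h)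
  · intro h b
    rw [h]
    exact le_iSup (qOpt D.predictive D.reward _ n z) b

/-! ### The Lagrangian -/

theorem expTau_eq (π : Policy X A) :
    M.expTau π = 1 + expQueries D.predictive π 0 M.initLaw := by
  have hm : Measurable fun t : Traj X A => ((t.1 + 1 : ℕ) : ℝ≥0∞) :=
    measurable_traj fun m => measurable_const (a := ((m + 1 : ℕ) : ℝ≥0∞))
  have huniv : M.pathLaw π Set.univ = D.trajLaw π Set.univ := by
    rw [← lintegral_one, D.lintegral_pathLaw π (f := fun _ => 1) measurable_const]
    simp
  have h1 : M.expTau π = D.trajLaw π Set.univ + expQueries D.predictive π 0 M.initLaw := by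
    have h2 : ∫⁻ t, ((t.1 + 1 : ℕ) : ℝ≥0∞) ∂D.trajLaw π =
        D.trajLaw π Set.univ + ∫⁻ t, ((t.1 - 0 : ℕ) : ℝ≥0∞) ∂D.trajLaw π := by
      rw [← lintegral_one, ← lintegral_add_left measurable_const]
      refine lintegral_congr fun t => ?_
      simp [add_comm]
    rw [← lintegral_length_stoppedLaw, Model.expTau, huniv,
      D.lintegral_pathLaw π (f := fun p => ((p.2.1 + 1 : ℕ) : ℝ≥0∞)) (hm.comp measurable_snd)]
    simp only [lintegral_const, measure_univ, mul_one]
    rw [h2, add_assoc]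
    rfl
  -- The summand `1` is the shift `τ = n + 1` times the stopped mass. That mass is `1` when the
  -- expected number of queries is finite; otherwise both sides are `⊤`.
  by_cases hE : expQueries D.predictive π 0 M.initLaw = ⊤
  · rw [h1, hE, add_top, add_top]
  · rw [h1]
    congr 1
    exact le_antisymm (stoppedLaw_univ_le _ π _)
      (tsub_eq_zero_iff_le.1 (one_sub_stoppedLaw_univ_eq_zero _ π _ hE))

theorem expMaxPosterior_eq (π : Policy X A) :
    D.expMaxPosterior π = (D.expReward π 0 M.initLaw).toReal := by
  rw [expMaxPosterior, D.integral_maxPosterior _ (g := fun p : Ω × Traj X A => p.2) measurable_snd,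
    D.lintegral_pathLaw π (f := fun p => D.reward p.2.1 p.2.2)
      ((measurable_traj (f := fun o => D.reward o.1 o.2) D.measurable_reward).comp measurable_snd)]
  simp [expReward, trajLaw]

/-- Conditioning on `D_τ`: a guess is right with its own posterior probability. -/
theorem correctness_eq (π : Policy X A) (I : InferenceRule X A 𝓗) :
    M.correctness π I =
      (∫⁻ t, D.posterior t.1 t.2 (M.truth ⁻¹' {I.guess t.1 t.2}) ∂D.trajLaw π).toReal := by
  have hg : Measurable fun t : Traj X A => I.guess t.1 t.2 := measurable_traj I.measurable_guess
  have hs : MeasurableSet {p : Ω × Traj X A | I.guess p.2.1 p.2.2 = M.truth p.1} :=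
    measurableSet_eq_fun (hg.comp measurable_snd) (M.measurable_truth.comp measurable_fst)
  rw [Model.correctness, Measure.real, ← lintegral_indicator_one hs,
    D.lintegral_pathLaw π (measurable_one.indicator hs)]
  congr 1
  refine lintegral_congr fun t => ?_
  rw [← lintegral_indicator_one (M.measurable_truth (measurableSet_singleton _))]
  refine lintegral_congr fun ω => ?_
  by_cases h : I.guess t.1 t.2 = M.truth ω
  · rw [Set.indicator_of_mem (s := {p : Ω × Traj X A | I.guess p.2.1 p.2.2 = M.truth p.1}) h,
      Set.indicator_of_mem (show ω ∈ M.truth ⁻¹' {I.guess t.1 t.2} from h.symm)]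
    rfl
  · rw [Set.indicator_of_notMem (s := {p : Ω × Traj X A | I.guess p.2.1 p.2.2 = M.truth p.1}) h,
      Set.indicator_of_notMem (show ω ∉ M.truth ⁻¹' {I.guess t.1 t.2} from Ne.symm h)]

theorem correctness_le (π : Policy X A) (I : InferenceRule X A 𝓗) :
    M.correctness π I ≤ D.expMaxPosterior π := by
  rw [D.correctness_eq, D.expMaxPosterior_eq]
  exact ENNReal.toReal_mono (D.expReward_ne_top π _) (lintegral_mono fun t =>
    le_iSup (fun H => D.posterior t.1 t.2 (M.truth ⁻¹' {H})) _)

theorem IsMAP.correctness_eq {I : InferenceRule X A 𝓗} (hI : D.IsMAP I) (π : Policy X A) :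
    M.correctness π I = D.expMaxPosterior π := by
  rw [D.correctness_eq, D.expMaxPosterior_eq]
  congr 1
  refine lintegral_congr fun t => le_antisymm
    (le_iSup (fun H => D.posterior t.1 t.2 (M.truth ⁻¹' {H})) _) (iSup_le fun H => ?_)
  exact (ENNReal.toReal_le_toReal (measure_ne_top _ _) (measure_ne_top _ _)).1 (hI t.1 t.2 H)

theorem exists_isMAP : ∃ I : InferenceRule X A 𝓗, D.IsMAP I := by
  -- The prior has mass `1`, so there is a parameter and hence a hypothesis to select.
  have : Nonempty Ω := nonempty_of_isProbabilityMeasure M.prior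
  have : Nonempty 𝓗 := this.map M.truth
  choose f hf hmax using fun n => exists_measurable_argmax
    (fun H z => D.posterior n z (M.truth ⁻¹' {H})) (D.measurable_posterior_truth n)
  refine ⟨⟨f, fun n => measurable_to_countable' (hf n)⟩, fun n z H => ?_⟩
  exact ENNReal.toReal_mono (measure_ne_top _ _) (hmax n z H)

/-- The expected optimal value at the first observation. -/
noncomputable def optValue (lam : ℝ) : ℝ :=
  (∫⁻ z, vOpt D.predictive D.reward (ENNReal.ofReal lam) 0 z ∂M.initLaw).toReal

/-- The optimal value of the Lagrangian. -/
noncomputable def dualReal (δ lam : ℝ) : ℝ := D.optValue lam - 1 + lam * (δ - 1)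

variable {δ : ℝ}

theorem lagrangian_le_policyLagrangian (hlam : 0 ≤ lam) (π : Policy X A)
    (I : InferenceRule X A 𝓗) : M.lagrangian δ lam π I ≤ D.policyLagrangian δ lam π := by
  refine add_le_add le_rfl (EReal.coe_le_coe_iff.2 ?_)
  have := D.correctness_le π I
  gcongr

theorem IsMAP.lagrangian_eq {I : InferenceRule X A 𝓗} (hI : D.IsMAP I) (π : Policy X A) :
    M.lagrangian δ lam π I = D.policyLagrangian δ lam π := by
  rw [Model.lagrangian, policyLagrangian, IsMAP.correctness_eq D hI]

theorem policyLagrangian_le (hlam : 0 ≤ lam) (π : Policy X A) :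
    D.policyLagrangian δ lam π ≤ (D.dualReal δ lam : EReal) := by
  rw [policyLagrangian, D.expTau_eq, D.expMaxPosterior_eq]
  refine neg_coe_add_coe_le fun hE => ?_
  have hE' : expQueries D.predictive π 0 M.initLaw ≠ ⊤ := (ENNReal.add_ne_top.1 hE).2
  rw [ENNReal.toReal_add ENNReal.one_ne_top hE', ENNReal.toReal_one, dualReal, optValue]
  linarith [D.mul_expReward_le π M.initLaw hlam hE']

theorem policyLagrangian_eq (hlam : 0 ≤ lam) {π : Policy X A} (hπ : D.IsGreedy lam π) :
    D.policyLagrangian δ lam π = (D.dualReal δ lam : EReal) := by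
  rw [D.isGreedy_iff hlam] at hπ
  have hE := D.expQueries_ne_top M.initLaw hπ
  rw [policyLagrangian, D.expTau_eq, D.expMaxPosterior_eq,
    neg_coe_add_coe (ENNReal.add_ne_top.2 ⟨ENNReal.one_ne_top, hE⟩),
    ENNReal.toReal_add ENNReal.one_ne_top hE, ENNReal.toReal_one, dualReal, optValue]
  congr 1
  linarith [D.mul_expReward_eq M.initLaw hlam hπ]

theorem isOptimalPolicy_of_isGreedy (hlam : 0 ≤ lam) {π : Policy X A} (hπ : D.IsGreedy lam π) :
    D.IsOptimalPolicy δ lam π := fun π' => by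
  rw [D.policyLagrangian_eq hlam hπ]
  exact D.policyLagrangian_le hlam π'

theorem dual_eq (hlam : 0 ≤ lam) : M.dual δ lam = (D.dualReal δ lam : EReal) := by
  apply le_antisymm
  · exact iSup_le fun π => iSup_le fun I =>
      (D.lagrangian_le_policyLagrangian hlam π I).trans (D.policyLagrangian_le hlam π)
  · obtain ⟨π, -, hπ, -⟩ := D.exists_playsOptimal_predictive lam
    obtain ⟨I, hI⟩ := D.exists_isMAP
    rw [← D.policyLagrangian_eq hlam ((D.isGreedy_iff hlam π).2 hπ), ← IsMAP.lagrangian_eq D hI]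
    exact le_iSup₂ (f := fun π I => M.lagrangian δ lam π I) π I

theorem isDualOptimal_iff :
    M.IsDualOptimal δ lam ↔ 0 ≤ lam ∧ ∀ lam', 0 ≤ lam' → D.dualReal δ lam ≤ D.dualReal δ lam' := by
  refine and_congr_right fun hlam => forall₂_congr fun lam' hlam' => ?_
  rw [D.dual_eq hlam, D.dual_eq hlam', EReal.coe_le_coe_iff]

/-! ### The dual problem -/

/-- The bound of `vOpt_add_le`, integrated. `ENNReal.ofReal` clips negative multipliers, so no sign
condition is needed. -/
theorem lipschitzWith_optValue : LipschitzWith 1 D.optValue := by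
  refine LipschitzWith.of_le_add fun x y => ?_
  have hxy : ENNReal.ofReal x ≤ ENNReal.ofReal y + ENNReal.ofReal (dist x y) := by
    refine (ENNReal.ofReal_le_ofReal ?_).trans ENNReal.ofReal_add_le
    rw [Real.dist_eq]
    linarith [le_abs_self (x - y)]
  have h : ∫⁻ z, vOpt D.predictive D.reward (ENNReal.ofReal x) 0 z ∂M.initLaw ≤
      ∫⁻ z, vOpt D.predictive D.reward (ENNReal.ofReal y) 0 z ∂M.initLaw +
        ENNReal.ofReal (dist x y) := by
    refine (lintegral_mono fun z => (vOpt_mono D.predictive hxy 0 z).trans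
      (vOpt_add_le D.predictive D.reward_le_one _ 0 z)).trans ?_
    rw [lintegral_add_right _ measurable_const]
    simp
  have h' := ENNReal.toReal_mono
    (ENNReal.add_ne_top.2 ⟨D.lintegral_vOpt_ne_top M.initLaw y, ENNReal.ofReal_ne_top⟩) h
  rwa [ENNReal.toReal_add (D.lintegral_vOpt_ne_top M.initLaw y) ENNReal.ofReal_ne_top,
    ENNReal.toReal_ofReal dist_nonneg] at h'

theorem continuous_dualReal (δ : ℝ) : Continuous (D.dualReal δ) :=
  (D.lipschitzWith_optValue.continuous.sub continuous_const).add
    (continuous_id.mul continuous_const)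

/-- A policy identifying up to `δ / 2` has a Lagrangian affine in the multiplier with slope at least
`δ / 2`. The dual function lies above it on `[0, ∞)`, so its minimum may be sought on a compact
interval. -/
theorem exists_isDualOptimal (hδ₀ : 0 < δ) (hid : D.Identifiable) :
    ∃ lam, M.IsDualOptimal δ lam := by
  obtain ⟨π, hτ, hπ⟩ := hid (δ / 2) (half_pos hδ₀)
  have hlow : ∀ lam, 0 ≤ lam → lam * (δ / 2) - (M.expTau π).toReal ≤ D.dualReal δ lam := by
    intro lam hlam
    have h := D.policyLagrangian_le (δ := δ) hlam π
    rw [policyLagrangian, neg_coe_add_coe hτ.ne, EReal.coe_le_coe_iff] at h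
    refine le_trans ?_ h
    gcongr
    linarith
  -- Beyond `B` the affine lower bound exceeds the dual value at `0`.
  set B : ℝ := max 0 ((D.dualReal δ 0 + (M.expTau π).toReal) / (δ / 2)) with hB
  have hB0 : 0 ≤ B := le_max_left _ _
  obtain ⟨lam, hmem, hmin⟩ := isCompact_Icc.exists_isMinOn (Set.nonempty_Icc.2 hB0)
    (D.continuous_dualReal δ).continuousOn
  refine ⟨lam, D.isDualOptimal_iff.2 ⟨hmem.1, fun lam' hlam' => ?_⟩⟩
  by_cases hle : lam' ≤ B
  · exact hmin ⟨hlam', hle⟩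
  · have h0 : D.dualReal δ lam ≤ D.dualReal δ 0 := hmin ⟨le_rfl, hB0⟩
    have h1 : (D.dualReal δ 0 + (M.expTau π).toReal) / (δ / 2) ≤ lam' :=
      (le_max_right _ _).trans (not_le.1 hle).le
    rw [div_le_iff₀ (half_pos hδ₀)] at h1
    linarith [hlow lam' hlam']

theorem ofReal_inv_natCast_add_one (k : ℕ) : ENNReal.ofReal (((k : ℝ) + 1)⁻¹) = incr k := by
  rw [incr, ENNReal.ofReal_inv_of_pos (by positivity),
    ENNReal.ofReal_add (by positivity) zero_le_one]
  simp

/-- At a dual optimum some greedy policy reaches the required confidence. -/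
theorem exists_isGreedy_le_expMaxPosterior (hδ₁ : δ < 1) (hlam : M.IsDualOptimal δ lam) :
    ∃ π, D.IsGreedy lam π ∧ 1 - δ ≤ D.expMaxPosterior π := by
  obtain ⟨h0, hmin⟩ := D.isDualOptimal_iff.1 hlam
  obtain ⟨π, -, hπ, hder⟩ := D.exists_playsOptimal_predictive lam
  refine ⟨π, (D.isGreedy_iff h0 π).2 hπ, ?_⟩
  have hd : ENNReal.ofReal (1 - δ) ≤ D.expReward π 0 M.initLaw := by
    refine le_trans (le_lintegral_vDer D.predictive D.measurable_reward D.reward_le_one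
      (l := ENNReal.ofReal lam) ENNReal.ofReal_ne_top M.initLaw fun k => ?_)
      (lintegral_vDer_le D.predictive D.measurable_reward D.reward_le_one ENNReal.ofReal_ne_top hπ
        hder M.initLaw)
    have hk : (0 : ℝ) ≤ ((k : ℝ) + 1)⁻¹ := by positivity
    -- Only increases of the multiplier are compared, so `lam = 0` needs no separate treatment.
    -- Rearranged, minimality says that `optValue` has right slopes at least `1 - δ`.
    have h := hmin (lam + ((k : ℝ) + 1)⁻¹) (by positivity)
    have h' : D.optValue lam + (1 - δ) * ((k : ℝ) + 1)⁻¹ ≤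
        D.optValue (lam + ((k : ℝ) + 1)⁻¹) := by
      simp only [dualReal] at h
      nlinarith
    rw [← ofReal_inv_natCast_add_one, ← ENNReal.ofReal_mul (by linarith),
      ← ENNReal.ofReal_add h0 hk, ← ENNReal.ofReal_toReal (D.lintegral_vOpt_ne_top M.initLaw lam),
      ← ENNReal.ofReal_add ENNReal.toReal_nonneg (mul_nonneg (by linarith) hk)]
    exact ENNReal.ofReal_le_of_le_toReal h'
  rw [D.expMaxPosterior_eq]
  exact (ENNReal.ofReal_le_iff_le_toReal (D.expReward_ne_top π _)).1 hd

end Model.Domination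

end Theorem

end PureExploration

/-! ### The main theorem -/

open PureExploration
theorem theorem3p3 {Ω X A 𝓗 : Type*}
    [MetricSpace Ω] [CompactSpace Ω] [MeasurableSpace Ω] [BorelSpace Ω]
    [MetricSpace X] [CompactSpace X] [MeasurableSpace X] [BorelSpace X]
    [Fintype A] [TopologicalSpace A] [DiscreteTopology A] [MeasurableSpace A]
    [DiscreteMeasurableSpace A]
    [Fintype 𝓗] [MeasurableSpace 𝓗] [DiscreteMeasurableSpace 𝓗]
    (M : Model Ω X A 𝓗) (D : M.Domination) (δ : ℝ) (hδ₀ : 0 < δ) (hδ₁ : δ < 1) :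
    -- optimality of greedy policies with maximum a posteriori inference, for every multiplier
    (∀ lam : ℝ, 0 ≤ lam →
      -- the action values satisfy the recursion
      (∀ n (z : Hist X A n),
        D.qValue lam n z none = lam * D.maxPosterior n z ∧
        ∀ a : A,
          Integrable (fun x => ⨆ b, D.qValue lam (n + 1) (z.snoc a x) b)
            (D.predictive n (z, a)) ∧
          D.qValue lam n z (some a) =
            -1 + ∫ x, (⨆ b, D.qValue lam (n + 1) (z.snoc a x) b) ∂(D.predictive n (z, a))) ∧
      -- deterministic greedy policies and maximum a posteriori rules exist
      (∃ π : Policy X A, D.IsGreedy lam π ∧ ∀ n z, ∃ a, π.prob n z a = 1) ∧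
      (∃ I : InferenceRule X A 𝓗, D.IsMAP I) ∧
      -- all such pairs are optimal
      (∀ (π : Policy X A) (I : InferenceRule X A 𝓗), D.IsGreedy lam π → D.IsMAP I →
        ∀ (π' : Policy X A) (I' : InferenceRule X A 𝓗),
          M.lagrangian δ lam π' I' ≤ M.lagrangian δ lam π I)) ∧
    -- correctness at the optimal multipliers
    (D.Identifiable →
      (∃ lam, M.IsDualOptimal δ lam) ∧
      ∀ lam, M.IsDualOptimal δ lam → D.UniqueOptimalPolicy δ lam →
        ∀ (π : Policy X A) (I : InferenceRule X A 𝓗), D.IsGreedy lam π → D.IsMAP I →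
          1 - δ ≤ M.correctness π I) := by
  refine ⟨fun lam hlam => ⟨fun n z => ⟨rfl, fun a => ?_⟩, ?_, D.exists_isMAP, ?_⟩, fun hid =>
    ⟨D.exists_isDualOptimal hδ₀ hid, ?_⟩⟩
  · simp only [D.iSup_qValue hlam]
    exact ⟨D.integrable_value hlam n z a, rfl⟩
  · obtain ⟨π, hdet, hπ, -⟩ := D.exists_playsOptimal_predictive lam
    exact ⟨π, (D.isGreedy_iff hlam π).2 hπ, hdet⟩
  · intro π I hπ hI π' I'
    rw [Model.Domination.IsMAP.lagrangian_eq D hI]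
    exact (D.lagrangian_le_policyLagrangian hlam π' I').trans
      (D.isOptimalPolicy_of_isGreedy hlam hπ π')
  · intro lam hlam huniq π I hπ hI
    obtain ⟨π', hπ', hle⟩ := D.exists_isGreedy_le_expMaxPosterior hδ₁ hlam
    -- Greedy policies are all optimal, so uniqueness gives the two the same path law and thus the
    -- same expected maximal posterior.
    have heq : M.pathLaw π = M.pathLaw π' := huniq π π' (D.isOptimalPolicy_of_isGreedy hlam.1 hπ)
      (D.isOptimalPolicy_of_isGreedy hlam.1 hπ')
    rw [Model.Domination.IsMAP.correctness_eq D hI, Model.Domination.expMaxPosterior, heq]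
    exact hle
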